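/- For $p\in(0,1)$ let $X_1,X_2,\dots$ be independent random variables with $\mathbf P[X_n=j]=p(1-p)^{j-1}$ for every integer $j\ge 1$. Let $\Pi_1,\Pi_2,\dots$ be the distinct values of the sequence $(X_n)_{n\ge1}$ in order of appearance, and let $$K=K_p=\inf\{k\ge 1:\ \{\Pi_1,\dots,\Pi_k\}=\{1,\dots,k\}\},\qquad \inf\emptyset=\infty.$$ Let $$b=\log 2-\int_0^\infty\log\bigl(1-2^{-e^{y}}\bigr)\,dy\approx 1.1524.$$ Then, for every $\varepsilon>0$, $$\mathbf P\bigl[K>e^{(b-\varepsilon)/p}\bigr]\longrightarrow 1\quad\text{as }p\downarrow 0,$$ and, moreover, $p\log K\to b$ in probability as $p\downarrow 0$; that is, for every $\delta>0$, the probability that $K<\infty$ and $|p\log K-b|<\delta$ tends to $1$. -/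

import Mathlib

open MeasureTheory ProbabilityTheory Filter Topology

namespace BiasedPermutation

/-- The sequence `x 0, x 1, …` shows a value for the first time at index `n`. -/
def IsNew (x : ℕ → ℕ) (n : ℕ) : Prop := ∀ m < n, x m ≠ x n

/-- The sequence `Π 1, Π 2, …` of distinct values of `x 0, x 1, …` in order of appearance:
`Π i` is the value at the `i`-th index (counted from `i = 1`) showing a new value.
If `x` has only finitely many distinct values, then `Π i` for larger `i` repeats the value `x 0`
(so that no `k` beyond the number of distinct values satisfies `Π [k] = [k]`). -/
noncomputable def perm (x : ℕ → ℕ) (i : ℕ) : ℕ := x (Nat.nth (IsNew x) (i - 1))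

/-- The size of the first block: the least `k ≥ 1` with `Π [k] = [k]`, where `[k] = {1, …, k}`,
and `⊤` if there is no such `k`. -/
noncomputable def blockSize (x : ℕ → ℕ) : ℕ∞ :=
  ⨅ (k : ℕ) (_ : 1 ≤ k ∧ perm x '' Set.Icc 1 k = Set.Icc 1 k), (k : ℕ∞)

/-- The constant `b = log 2 - ∫₀^∞ log (1 - 2 ^ (-e ^ y)) dy`. -/
noncomputable def b : ℝ :=
  Real.log 2 - ∫ y in Set.Ioi (0 : ℝ), Real.log (1 - (2 : ℝ) ^ (-Real.exp y))

end BiasedPermutation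

/-!
A block ends at `k` when the set of values seen so far equals `{1, …, k}` at some time (`Fills`),
and `K` is the first such `k ≥ 1` (`blockSize_cases`). Write `q = 1 - p` and let `u k` be the
probability that a block ends at `k` (`fillProb`). The proof has three ingredients.

*Chain of seen sets.* The set of values seen is a Markov chain on finite sets, so every probability
of interest solves a one-step recursion in the initial set (`first_step`, `prob_step`). On the
subsets of `{1, …, N}` such a recursion is a triangular linear system and has a unique solution
(`eq_zero_of_step`). All identities between probabilities are obtained by comparing two solutions.

*Renewal structure.* By the lack of memory of the geometric law, the ends of blocks form a renewal
set (`prob_fills_and_avoids`, `prob_avoids_Icc`). The events "the last end of a block up to `N` is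
`k`", `0 ≤ k ≤ N`, are disjoint with probabilities at least `u k * P (K > N)`, hence
`(N + 1) * min u * P (K > N) ≤ 1` (`renewal_bound`). In the other direction,
`P (K ≤ N) ≤ ∑ k ≤ N, u k` by the union bound. So `K` is of order `1 / u k` for large `k`, on the
exponential scale.

*Size of `u k`.* With independent exponential clocks in place of the draws,
`u k = ∫₀^∞ e ^ (-s) ∏_{i=1}^k (1 - exp (-p q ^ (-i) s)) ds` (`fillProb_eq`). Put
`p s = log 2 * e ^ c`. Since `q ^ (-i)` is a geometric progression with logarithmic spacing about
`p`, the integrand is close to `exp (-(log 2 * e ^ c + ∫ y in c..∞, h y) / p)` where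
`h y = -log (1 - 2 ^ (-e ^ y))` is decreasing with `h 0 = log 2`. The exponent is extremal at
`c = 0`, where the bracket equals `b`. Monotonicity of `h` turns this into the bounds
`e ^ (-b / p - 1) ≤ u k` for every `k` (`le_fillProb`) and `u k ≤ e ^ (-(b - o(1)) / p) / p` once
`p k` is large (`fillProb_le_exp`). The remaining `O(1 / p)` values of `k` contribute `O(p)` to the
union bound, because `u 1 = O(p)` and `u k = O(p ^ 2)` for `k ≥ 2`.
-/

namespace BiasedPermutation

/-! ### Blocks and the set of values seen -/

/-- The set of values seen after `n` draws `x 0, …, x (n - 1)`, starting from the set `s`. -/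
def seen (s : Finset ℕ) (x : ℕ → ℕ) (n : ℕ) : Finset ℕ := s ∪ (Finset.range n).image x

/-- Starting from `s`, the set of values seen equals `{1, …, k}` at some time. For `s = ∅` this is
the event that the first `k` distinct values are `1, …, k` in some order, see `perm_image_eq_iff`. -/
def Fills (s : Finset ℕ) (k : ℕ) (x : ℕ → ℕ) : Prop := ∃ n, seen s x n = Finset.Icc 1 k

lemma exists_isNew_le (x : ℕ → ℕ) (m : ℕ) : ∃ j ≤ m, IsNew x j ∧ x j = x m := by
  classical
  have h : ∃ j, x j = x m := ⟨m, rfl⟩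
  refine ⟨Nat.find h, Nat.find_min' h rfl, fun i hi hx => ?_, Nat.find_spec h⟩
  exact Nat.find_min h hi (hx.trans (Nat.find_spec h))

lemma injOn_isNew (x : ℕ → ℕ) : Set.InjOn x {n | IsNew x n} := by
  intro m hm n hn h
  rcases lt_trichotomy m n with hlt | heq | hgt
  · exact absurd h (hn m hlt)
  · exact heq
  · exact absurd h.symm (hm n hgt)

open scoped Classical in
lemma card_image_range (x : ℕ → ℕ) (n : ℕ) :
    ((Finset.range n).image x).card = Nat.count (IsNew x) n := by
  have himg : (Finset.range n).image x = ((Finset.range n).filter (IsNew x)).image x := by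
    ext v
    simp only [Finset.mem_image, Finset.mem_range, Finset.mem_filter]
    constructor
    · rintro ⟨m, hm, rfl⟩
      obtain ⟨j, hj, hnew, hx⟩ := exists_isNew_le x m
      exact ⟨j, ⟨by omega, hnew⟩, hx⟩
    · rintro ⟨m, hm, rfl⟩
      exact ⟨m, hm.1, rfl⟩
  rw [himg, Finset.card_image_of_injOn, Nat.count_eq_card_filter_range]
  intro m hm n hn h
  exact injOn_isNew x (by simpa using (Finset.mem_filter.1 hm).2)
    (by simpa using (Finset.mem_filter.1 hn).2) h

open scoped Classical in
/-- Once `k` new values have been shown, `Π 1, …, Π k` are exactly the values seen so far. -/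
lemma perm_image_Icc {x : ℕ → ℕ} {n k : ℕ} (h : Nat.count (IsNew x) n = k) :
    perm x '' Set.Icc 1 k = ((Finset.range n).image x : Finset ℕ) := by
  ext v
  simp only [Set.mem_image, Set.mem_Icc, Finset.coe_image, Finset.coe_range, Set.mem_Iio, perm]
  constructor
  · rintro ⟨i, ⟨h1, h2⟩, rfl⟩
    exact ⟨_, Nat.nth_lt_of_lt_count (by omega), rfl⟩
  · rintro ⟨m, hm, rfl⟩
    obtain ⟨j, hj, hnew, hx⟩ := exists_isNew_le x m
    have hlt : Nat.count (IsNew x) j < k := h ▸ Nat.count_strict_mono hnew (by omega)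
    refine ⟨Nat.count (IsNew x) j + 1, ⟨by omega, by omega⟩, ?_⟩
    rw [Nat.add_sub_cancel, Nat.nth_count hnew, hx]

lemma perm_image_eq_iff (x : ℕ → ℕ) (k : ℕ) :
    perm x '' Set.Icc 1 k = Set.Icc 1 k ↔ Fills ∅ k x := by
  classical
  constructor
  · intro h
    -- If fewer than `k` values ever appear, the image on the left has fewer than `k` elements.
    have hlen : ∀ hf : (Set.ofPred (IsNew x)).Finite, k ≤ hf.toFinset.card := by
      intro hf
      by_contra! hlt
      have hsub : Finset.Icc 1 k ⊆ hf.toFinset.image x := by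
        intro v hv
        have hv' : v ∈ perm x '' Set.Icc 1 k := by rw [h]; simpa using hv
        obtain ⟨i, -, rfl⟩ := hv'
        obtain ⟨j, -, hnew, hx⟩ := exists_isNew_le x (Nat.nth (IsNew x) (i - 1))
        exact Finset.mem_image.2 ⟨j, by simpa using hnew, hx⟩
      have := (Finset.card_le_card hsub).trans Finset.card_image_le
      simp at this
      omega
    have hn : ∃ n, Nat.count (IsNew x) n = k := by
      cases k with
      | zero => exact ⟨0, Nat.count_zero _⟩
      | succ k => exact ⟨_, Nat.count_nth_succ fun hf => hlen hf⟩
    obtain ⟨n, hn⟩ := hn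
    refine ⟨n, ?_⟩
    rw [perm_image_Icc hn] at h
    apply Finset.coe_injective
    simpa [seen] using h
  · rintro ⟨n, hn⟩
    simp only [seen, Finset.empty_union] at hn
    have hk : Nat.count (IsNew x) n = k := by
      rw [← card_image_range, hn]; simp
    rw [perm_image_Icc hk, hn]
    simp

/-- The block size is the least `k ≥ 1` with `Fills ∅ k x`, if there is one. -/
lemma blockSize_cases (x : ℕ → ℕ) :
    (blockSize x = ⊤ ∧ ∀ k, 1 ≤ k → ¬ Fills ∅ k x) ∨
      ∃ k : ℕ, blockSize x = k ∧ 1 ≤ k ∧ Fills ∅ k x ∧ ∀ j, 1 ≤ j → j < k → ¬ Fills ∅ j x := by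
  classical
  have hbs : blockSize x = ⨅ (k : ℕ) (_ : 1 ≤ k ∧ Fills ∅ k x), (k : ℕ∞) := by
    simp only [blockSize, perm_image_eq_iff]
  by_cases h : ∃ k, 1 ≤ k ∧ Fills ∅ k x
  · right
    refine ⟨Nat.find h, ?_, (Nat.find_spec h).1, (Nat.find_spec h).2,
      fun j hj hlt hf => Nat.find_min h hlt ⟨hj, hf⟩⟩
    rw [hbs]
    apply le_antisymm
    · exact iInf₂_le (Nat.find h) (Nat.find_spec h)
    · exact le_iInf₂ fun k hk => by exact_mod_cast Nat.find_min' h hk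
  · left
    push Not at h
    refine ⟨?_, h⟩
    rw [hbs]
    simp only [iInf_eq_top]
    exact fun k hk => absurd hk.2 (h k hk.1)

/-! ### First-step analysis for an i.i.d. sequence -/

/-- The sequence `j, y 0, y 1, …`. -/
def consSeq (j : ℕ) (y : ℕ → ℕ) : ℕ → ℕ
  | 0 => j
  | n + 1 => y n

lemma measurable_consSeq : Measurable fun z : ℕ × (ℕ → ℕ) => consSeq z.1 z.2 := by
  refine measurable_pi_iff.2 fun n => ?_
  cases n with
  | zero => exact measurable_fst
  | succ n => exact (measurable_pi_apply n).comp measurable_snd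

/-- The law of an i.i.d. sequence with marginals `ν`. -/
noncomputable def iidLaw (ν : Measure ℕ) [IsProbabilityMeasure ν] : Measure (ℕ → ℕ) :=
  Measure.infinitePi fun _ => ν

instance (ν : Measure ℕ) [IsProbabilityMeasure ν] : IsProbabilityMeasure (iidLaw ν) := by
  unfold iidLaw; infer_instance

lemma map_consSeq (ν : Measure ℕ) [IsProbabilityMeasure ν] :
    (ν.prod (iidLaw ν)).map (fun z => consSeq z.1 z.2) = iidLaw ν := by
  refine Measure.eq_infinitePi _ fun s t ht => ?_
  classical
  obtain ⟨n, hn⟩ : ∃ n, s ⊆ Finset.range (n + 1) :=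
    ⟨s.sup id, fun i hi => Finset.mem_range.2 (Nat.lt_succ_of_le (Finset.le_sup (f := id) hi))⟩
  -- Unconstrained coordinates get the factor `univ`, so the box is one over an initial segment.
  set t' : ℕ → Set ℕ := fun i => if i ∈ s then t i else Set.univ with ht'
  have ht'm : ∀ i, MeasurableSet (t' i) := fun i => MeasurableSet.of_discrete
  have hprod : ∏ i ∈ s, ν (t i) = ∏ i ∈ Finset.range (n + 1), ν (t' i) := by
    rw [← Finset.prod_subset hn (f := fun i => ν (t' i))]
    · refine Finset.prod_congr rfl fun i hi => ?_
      simp [ht', hi]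
    · intro i _ hi
      simp [ht', hi]
  have hpre : (fun z : ℕ × (ℕ → ℕ) => consSeq z.1 z.2) ⁻¹' (Set.pi s t) =
      t' 0 ×ˢ Set.pi (Finset.range n) (fun i => t' (i + 1)) := by
    ext ⟨j, y⟩
    simp only [Set.mem_preimage, Set.mem_pi, Set.mem_prod, Finset.mem_coe, Finset.mem_range, ht']
    constructor
    · intro h
      refine ⟨?_, fun i _ => ?_⟩
      · split_ifs with h0
        · exact h 0 h0
        · trivial
      · split_ifs with h0
        · exact h (i + 1) h0
        · trivial
    · rintro ⟨h0, h1⟩ i hi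
      cases i with
      | zero => simpa [hi, consSeq] using h0
      | succ i =>
        have := h1 i (by have := Finset.mem_range.1 (hn hi); omega)
        simpa [hi, consSeq] using this
  rw [Measure.map_apply measurable_consSeq
    (MeasurableSet.pi s.countable_toSet fun i _ => ht i), hpre, Measure.prod_prod, iidLaw,
    Measure.infinitePi_pi _ fun i _ => ht'm (i + 1), hprod, Finset.prod_range_succ', mul_comm]

/-- Conditioning on the first draw. -/
lemma first_step (ν : Measure ℕ) [IsProbabilityMeasure ν] {E : Set (ℕ → ℕ)}
    (hE : MeasurableSet E) :
    (iidLaw ν).real E = ∑' j, ν.real {j} * (iidLaw ν).real {y | consSeq j y ∈ E} := by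
  have h1 : iidLaw ν E = ∑' j, iidLaw ν {y | consSeq j y ∈ E} * ν {j} := by
    conv_lhs => rw [← map_consSeq ν]
    rw [Measure.map_apply measurable_consSeq hE,
      Measure.prod_apply (measurable_consSeq hE), lintegral_countable']
    rfl
  rw [measureReal_def, h1, ENNReal.tsum_toReal_eq
    fun j => ENNReal.mul_ne_top (measure_ne_top _ _) (measure_ne_top _ _)]
  simp only [ENNReal.toReal_mul, measureReal_def, mul_comm]

@[simp] lemma seen_zero (s : Finset ℕ) (x : ℕ → ℕ) : seen s x 0 = s := by simp [seen]

lemma subset_seen (s : Finset ℕ) (x : ℕ → ℕ) (n : ℕ) : s ⊆ seen s x n :=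
  Finset.subset_union_left

lemma seen_consSeq_succ (s : Finset ℕ) (j : ℕ) (y : ℕ → ℕ) (n : ℕ) :
    seen s (consSeq j y) (n + 1) = seen (insert j s) y n := by
  ext v
  simp only [seen, Finset.mem_union, Finset.mem_image, Finset.mem_range, Finset.mem_insert]
  constructor
  · rintro (h | ⟨i, hi, rfl⟩)
    · exact Or.inl (Or.inr h)
    · cases i with
      | zero => exact Or.inl (Or.inl rfl)
      | succ i => exact Or.inr ⟨i, by omega, rfl⟩
  · rintro ((rfl | h) | ⟨i, hi, rfl⟩)
    · exact Or.inr ⟨0, by omega, rfl⟩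
    · exact Or.inl h
    · exact Or.inr ⟨i + 1, by omega, rfl⟩

lemma measurableSet_seen_eq (s t : Finset ℕ) (n : ℕ) : MeasurableSet {x | seen s x n = t} := by
  have h : {x : ℕ → ℕ | seen s x n = t} =
      (fun x (i : Fin n) => x i) ⁻¹' {z | s ∪ Finset.univ.image z = t} := by
    ext x
    have : (Finset.range n).image x = Finset.univ.image fun i : Fin n => x i := by
      ext v
      simp only [Finset.mem_image, Finset.mem_range, Finset.mem_univ, true_and]
      exact ⟨fun ⟨i, hi, h⟩ => ⟨⟨i, hi⟩, h⟩, fun ⟨i, h⟩ => ⟨i, i.2, h⟩⟩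
    simp [seen, this]
  rw [h]
  exact (measurable_pi_iff.2 fun i => measurable_pi_apply _) MeasurableSet.of_discrete

lemma measurableSet_fills (s : Finset ℕ) (k : ℕ) : MeasurableSet {x | Fills s k x} := by
  simp only [Fills, Set.ofPred_exists]
  exact MeasurableSet.iUnion fun n => measurableSet_seen_eq s _ n

lemma fills_consSeq {s : Finset ℕ} {k : ℕ} (hs : s ≠ Finset.Icc 1 k) (j : ℕ) (y : ℕ → ℕ) :
    Fills s k (consSeq j y) ↔ Fills (insert j s) k y := by
  constructor
  · rintro ⟨n, hn⟩
    cases n with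
    | zero => exact absurd hn (by simpa using hs)
    | succ n => exact ⟨n, by rwa [seen_consSeq_succ] at hn⟩
  · rintro ⟨n, hn⟩
    exact ⟨n + 1, by rwa [seen_consSeq_succ]⟩

lemma Fills.subset {s : Finset ℕ} {k : ℕ} {x : ℕ → ℕ} (h : Fills s k x) : s ⊆ Finset.Icc 1 k := by
  obtain ⟨n, hn⟩ := h
  exact hn ▸ subset_seen s x n

lemma fills_self (k : ℕ) (x : ℕ → ℕ) : Fills (Finset.Icc 1 k) k x := ⟨0, by simp⟩

/-- Starting from `s`, the set of values seen is never `{1, …, m}` for any `k < m ≤ N`. -/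
def Avoids (s : Finset ℕ) (k N : ℕ) (x : ℕ → ℕ) : Prop := ∀ m ∈ Finset.Ioc k N, ¬ Fills s m x

lemma measurableSet_avoids (s : Finset ℕ) (k N : ℕ) : MeasurableSet {x | Avoids s k N x} := by
  simp only [Avoids, Set.ofPred_forall]
  exact MeasurableSet.iInter fun m => MeasurableSet.iInter fun _ =>
    (measurableSet_fills s m).compl

lemma avoids_consSeq {s : Finset ℕ} {k N : ℕ} (hs : ∀ m ∈ Finset.Ioc k N, s ≠ Finset.Icc 1 m)
    (j : ℕ) (y : ℕ → ℕ) : Avoids s k N (consSeq j y) ↔ Avoids (insert j s) k N y :=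
  forall₂_congr fun m hm => not_congr (fills_consSeq (hs m hm) j y)

/-- The probabilities `p (1 - p) ^ (j - 1)`, `j ≥ 1`, extended by `0` to `j = 0`. -/
noncomputable def geo (p : ℝ) : ℕ → ℝ
  | 0 => 0
  | j + 1 => p * (1 - p) ^ j

lemma geo_pos {p : ℝ} (hp : p ∈ Set.Ioo (0 : ℝ) 1) {j : ℕ} (hj : 1 ≤ j) : 0 < geo p j := by
  obtain ⟨j, rfl⟩ := Nat.exists_eq_add_of_le' hj
  have := hp.1
  have := sub_pos.2 hp.2
  simp only [geo]; positivity

lemma geo_nonneg {p : ℝ} (hp : p ∈ Set.Ioo (0 : ℝ) 1) (j : ℕ) : 0 ≤ geo p j := by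
  cases j with
  | zero => exact le_rfl
  | succ j => exact (geo_pos hp (by omega)).le

lemma hasSum_geo {p : ℝ} (hp : p ∈ Set.Ioo (0 : ℝ) 1) : HasSum (geo p) 1 := by
  rw [← hasSum_nat_add_iff' 1]
  simp only [geo, Finset.range_one, Finset.sum_singleton, sub_zero]
  have h := (hasSum_geometric_of_lt_one (sub_pos.2 hp.2).le
    (by linarith [hp.1] : 1 - p < 1)).mul_left p
  rwa [sub_sub_cancel, mul_inv_cancel₀ hp.1.ne'] at h

/-- The average of `f` over the states that follow `s` in one draw. -/
noncomputable def step (p : ℝ) (f : Finset ℕ → ℝ) (s : Finset ℕ) : ℝ :=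
  ∑' j, geo p j * f (insert j s)

/-- The one-step recursion on the subsets of `{1, …, N}` has at most one solution: a function that
solves it wherever it does not vanish, and vanishes when the chain leaves these sets, is zero. The
induction is on the number of elements still missing; draws from `s` itself have total probability
less than `1` and can be moved to the left-hand side. -/
lemma eq_zero_of_step {p : ℝ} (hp : p ∈ Set.Ioo (0 : ℝ) 1) {N : ℕ} {d : Finset ℕ → ℝ}
    (hout : ∀ s ⊆ Finset.Icc 1 N, ∀ j, N < j → d (insert j s) = 0)
    (hstep : ∀ s ⊆ Finset.Icc 1 N, d s = 0 ∨ d s = step p d s) :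
    ∀ s ⊆ Finset.Icc 1 N, d s = 0 := by
  intro s hs
  induction hn : (Finset.Icc 1 N \ s).card using Nat.strong_induction_on generalizing s with
  | _ n ih =>
    rcases hstep s hs with h | h
    · exact h
    have hterm : ∀ j, geo p j * d (insert j s) = d s * if j ∈ s then geo p j else 0 := by
      intro j
      by_cases hj : j ∈ s
      · rw [Finset.insert_eq_of_mem hj, if_pos hj, mul_comm]
      rw [if_neg hj, mul_zero]
      rcases Nat.eq_zero_or_pos j with rfl | hj0
      · simp [geo]
      rcases Nat.lt_or_ge N j with hN | hN
      · rw [hout s hs j hN, mul_zero]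
      have hmem : j ∈ Finset.Icc 1 N \ s := by
        simp only [Finset.mem_sdiff, Finset.mem_Icc]; exact ⟨⟨hj0, hN⟩, hj⟩
      rw [ih _ _ (insert j s) _ rfl, mul_zero]
      · rw [← hn, Finset.sdiff_insert]
        exact Finset.card_erase_lt_of_mem hmem
      · exact Finset.insert_subset (Finset.mem_sdiff.1 hmem).1 hs
    have hsum : ∑ j ∈ s, geo p j < 1 := by
      have hnot : N + 1 ∉ s := fun hmem => by have := Finset.mem_Icc.1 (hs hmem); omega
      have hle := sum_le_hasSum (insert (N + 1) s) (fun j _ => geo_nonneg hp j) (hasSum_geo hp)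
      rw [Finset.sum_insert hnot] at hle
      linarith [geo_pos hp (Nat.le_add_left 1 N)]
    have hs' : d s = d s * ∑ j ∈ s, geo p j := by
      conv_lhs => rw [h]
      unfold step
      simp_rw [hterm]
      rw [tsum_mul_left, tsum_eq_sum (s := s) fun j hj => if_neg hj]
      congr 1
      exact Finset.sum_congr rfl fun j hj => if_pos hj
    exact (mul_eq_zero.1 (show d s * (1 - ∑ j ∈ s, geo p j) = 0 by linarith)).resolve_right
      (by linarith)

lemma summable_step {p : ℝ} (hp : p ∈ Set.Ioo (0 : ℝ) 1) {f : ℕ → ℝ} {C : ℝ}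
    (hf : ∀ s, |f s| ≤ C) : Summable fun j => geo p j * f j := by
  refine Summable.of_norm_bounded ((hasSum_geo hp).summable.mul_right C) fun j => ?_
  rw [Real.norm_eq_abs, abs_mul, abs_of_nonneg (geo_nonneg hp j)]
  exact mul_le_mul_of_nonneg_left (hf _) (geo_nonneg hp j)

lemma step_sub {p : ℝ} (hp : p ∈ Set.Ioo (0 : ℝ) 1) {f g : Finset ℕ → ℝ} {C D : ℝ}
    (hf : ∀ s, |f s| ≤ C) (hg : ∀ s, |g s| ≤ D) (s : Finset ℕ) :
    step p (fun s => f s - g s) s = step p f s - step p g s := by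
  unfold step
  rw [← (summable_step hp fun j => hf _).tsum_sub (summable_step hp fun j => hg _)]
  simp only [mul_sub]

lemma abs_prob_le {α : Type*} [MeasurableSpace α] (μ : Measure α) [IsProbabilityMeasure μ]
    (E : Set α) : |μ.real E| ≤ 1 := by
  rw [abs_of_nonneg measureReal_nonneg]; exact measureReal_le_one

lemma prob_step {p : ℝ} {ν : Measure ℕ} [IsProbabilityMeasure ν]
    (hν : ∀ j, ν.real {j} = geo p j) {E : Finset ℕ → Set (ℕ → ℕ)} {s : Finset ℕ}
    (hE : MeasurableSet (E s)) (h : ∀ j y, consSeq j y ∈ E s ↔ y ∈ E (insert j s)) :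
    (iidLaw ν).real (E s) = step p (fun s => (iidLaw ν).real (E s)) s := by
  rw [first_step ν hE]
  simp only [hν, step, h, Set.ofPred_mem_eq]

/-! ### Regeneration -/

/-- The probability that the values `1, …, k` appear before all others. -/
noncomputable def fillProb (ν : Measure ℕ) [IsProbabilityMeasure ν] (k : ℕ) : ℝ :=
  (iidLaw ν).real {x | Fills ∅ k x}

/-- Once exactly `1, …, k` have been seen, the past is irrelevant. -/
lemma prob_fills_and_avoids {p : ℝ} (hp : p ∈ Set.Ioo (0 : ℝ) 1) {ν : Measure ℕ}
    [IsProbabilityMeasure ν] (hν : ∀ j, ν.real {j} = geo p j) (k N : ℕ) :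
    (iidLaw ν).real {x | Fills ∅ k x ∧ Avoids ∅ k N x} =
      fillProb ν k * (iidLaw ν).real {x | Avoids (Finset.Icc 1 k) k N x} := by
  set c := (iidLaw ν).real {x | Avoids (Finset.Icc 1 k) k N x} with hc
  have hE : ∀ s, MeasurableSet {x | Fills s k x ∧ Avoids s k N x} := fun s =>
    (measurableSet_fills s k).inter (measurableSet_avoids s k N)
  set L : Finset ℕ → ℝ := fun s => (iidLaw ν).real {x | Fills s k x ∧ Avoids s k N x} with hL
  set R : Finset ℕ → ℝ := fun s => (iidLaw ν).real {x | Fills s k x} with hR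
  have hL1 : ∀ s, |L s| ≤ 1 := fun s => abs_prob_le _ _
  have hR1 : ∀ s, |R s * c| ≤ 1 := fun s => by
    rw [abs_mul]; exact mul_le_one₀ (abs_prob_le _ _) (abs_nonneg _) (abs_prob_le _ _)
  have h0 := eq_zero_of_step hp (N := k) (d := fun s => L s - R s * c) ?_ ?_ ∅ (by simp)
  · exact sub_eq_zero.1 h0
  · intro s _ j hj
    have hno : ∀ x, ¬ Fills (insert j s) k x := fun x hx => by
      have := Finset.mem_Icc.1 (hx.subset (Finset.mem_insert_self j s)); omega
    simp [hL, hR, hno]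
  · intro s hs
    by_cases hsk : s = Finset.Icc 1 k
    · left
      subst hsk
      simp [hL, hR, fills_self, hc]
    · right
      have hne : ∀ m ∈ Finset.Ioc k N, s ≠ Finset.Icc 1 m := by
        rintro m hm rfl
        rw [Finset.mem_Ioc] at hm
        have := Finset.mem_Icc.1 (hs (Finset.mem_Icc.2 ⟨by omega, le_rfl⟩ : m ∈ Finset.Icc 1 m))
        omega
      rw [step_sub hp hL1 hR1]
      congr 1
      · exact prob_step hν (E := fun s => {x | Fills s k x ∧ Avoids s k N x}) (hE s) fun j y =>
          and_congr (fills_consSeq hsk j y) (avoids_consSeq hne j y)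
      · have := prob_step hν (E := fun s => {x | Fills s k x}) (measurableSet_fills s k)
          fun j y => fills_consSeq hsk j y
        simp only [hR]
        rw [this]
        simp only [step, ← tsum_mul_right, mul_assoc]

lemma sum_range_geo (p : ℝ) (k : ℕ) :
    ∑ j ∈ Finset.range (k + 1), geo p j = 1 - (1 - p) ^ k := by
  induction k with
  | zero => simp [geo]
  | succ k ih =>
    rw [Finset.sum_range_succ, ih, geo]
    ring

lemma geo_add (p : ℝ) (i k : ℕ) : geo p (i + 1 + k) = (1 - p) ^ k * geo p (i + 1) := by
  rw [show i + 1 + k = i + k + 1 by omega, geo, geo]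
  ring

/-- By the lack of memory of the geometric distribution, a sequence that has shown exactly
`1, …, k` continues as a fresh one in which all values are increased by `k`: the draws of
values `≤ k` do not change the state and can be discarded. -/
lemma prob_avoids_Icc {p : ℝ} (hp : p ∈ Set.Ioo (0 : ℝ) 1) {ν : Measure ℕ}
    [IsProbabilityMeasure ν] (hν : ∀ j, ν.real {j} = geo p j) (k N : ℕ) :
    (iidLaw ν).real {x | Avoids (Finset.Icc 1 k) k (k + N) x} =
      (iidLaw ν).real {x | Avoids ∅ 0 N x} := by
  classical
  set S : Finset ℕ → Finset ℕ := fun s => Finset.Icc 1 k ∪ s.image (· + k) with hS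
  set F : Finset ℕ → ℝ := fun s => (iidLaw ν).real {x | Avoids s k (k + N) x} with hF
  set G : Finset ℕ → ℝ := fun s => (iidLaw ν).real {x | Avoids s 0 N x} with hG
  have hF1 : ∀ s, |F s| ≤ 1 := fun s => abs_prob_le _ _
  have hG1 : ∀ s, |G s| ≤ 1 := fun s => abs_prob_le _ _
  have hSI : ∀ m, S (Finset.Icc 1 m) = Finset.Icc 1 (k + m) := by
    intro m
    ext v
    simp only [hS, Finset.mem_union, Finset.mem_Icc, Finset.mem_image]
    constructor
    · rintro (h | ⟨i, h, rfl⟩) <;> omega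
    · intro h
      rcases le_or_gt v k with hv | hv
      · exact Or.inl ⟨h.1, hv⟩
      · exact Or.inr ⟨v - k, by omega, by omega⟩
  have hmemS : ∀ s i, 1 ≤ i → (i + k ∈ S s ↔ i ∈ s) := by
    intro s i hi
    simp only [hS, Finset.mem_union, Finset.mem_Icc, Finset.mem_image, add_left_inj,
      exists_eq_right]
    constructor
    · rintro (h | h)
      · omega
      · exact h
    · exact Or.inr
  have hout : ∀ t : Finset ℕ, ∀ a b j, b < j → ∀ x, Avoids (insert j t) a b x := by
    intro t a b j hj x m hm hx
    have h1 := Finset.mem_Icc.1 (hx.subset (Finset.mem_insert_self j t))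
    have h2 := Finset.mem_Ioc.1 hm
    omega
  have hins : ∀ s j, S (insert j s) = insert (j + k) (S s) := by
    intro s j
    simp only [hS, Finset.image_insert, Finset.union_insert]
  have h0 := eq_zero_of_step hp (N := N) (d := fun s => F (S s) - G s) ?_ ?_ ∅ (by simp)
  · have := sub_eq_zero.1 h0
    simpa [hF, hG, hS] using this
  · intro s _ j hj
    have h1 : F (S (insert j s)) = 1 := by
      rw [hins]
      simp [hF, hout (S s) k (k + N) (j + k) (by omega)]
    have h2 : G (insert j s) = 1 := by
      simp [hG, hout s 0 N j hj]
    simp [h1, h2]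
  · intro s hs
    by_cases hm : ∃ m ∈ Finset.Ioc 0 N, s = Finset.Icc 1 m
    · left
      obtain ⟨m, hm, rfl⟩ := hm
      rw [Finset.mem_Ioc] at hm
      have h1 : ∀ x, ¬ Avoids (Finset.Icc 1 (k + m)) k (k + N) x := fun x hx =>
        hx (k + m) (Finset.mem_Ioc.2 (by omega)) (fills_self _ _)
      have h2 : ∀ x, ¬ Avoids (Finset.Icc 1 m) 0 N x := fun x hx =>
        hx m (Finset.mem_Ioc.2 hm) (fills_self _ _)
      simp [hSI, hF, hG, h1, h2]
    · right
      push Not at hm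
      have hm' : ∀ m ∈ Finset.Ioc k (k + N), S s ≠ Finset.Icc 1 m := by
        intro m hmk heq
        rw [Finset.mem_Ioc] at hmk
        refine hm (m - k) (Finset.mem_Ioc.2 (by omega)) ?_
        ext i
        constructor
        · intro hi
          have hi1 := Finset.mem_Icc.1 (hs hi)
          have := (hmemS s i hi1.1).2 hi
          rw [heq, Finset.mem_Icc] at this
          exact Finset.mem_Icc.2 (by omega)
        · intro hi
          rw [Finset.mem_Icc] at hi
          refine (hmemS s i hi.1).1 ?_
          rw [heq, Finset.mem_Icc]
          omega
      have hGs : G s = step p G s :=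
        prob_step hν (E := fun s => {x | Avoids s 0 N x}) (measurableSet_avoids s 0 N)
          fun j y => avoids_consSeq hm j y
      have hFs : F (S s) = step p F (S s) :=
        prob_step hν (E := fun s => {x | Avoids s k (k + N) x}) (measurableSet_avoids _ _ _)
          fun j y => avoids_consSeq hm' j y
      have hFsplit : step p F (S s) =
          (1 - (1 - p) ^ k) * F (S s) + (1 - p) ^ k * step p (fun s => F (S s)) s := by
        have e1 : step p F (S s) = ∑ j ∈ Finset.range (k + 1), geo p j * F (insert j (S s)) +
            ∑' j, geo p (j + (k + 1)) * F (insert (j + (k + 1)) (S s)) :=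
          ((summable_step hp fun j => hF1 (insert j (S s))).sum_add_tsum_nat_add (k + 1)).symm
        have e2 : step p (fun s => F (S s)) s =
            ∑' j, geo p (j + 1) * F (S (insert (j + 1) s)) := by
          have := (summable_step hp fun j => hF1 (S (insert j s))).sum_add_tsum_nat_add 1
          simp only [Finset.range_one, Finset.sum_singleton, geo, zero_mul, zero_add] at this
          exact this.symm
        rw [e1, e2, ← sum_range_geo, Finset.sum_mul, ← tsum_mul_left]
        congr 1
        · refine Finset.sum_congr rfl fun j hj => ?_
          rcases Nat.eq_zero_or_pos j with rfl | hj0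
          · simp [geo]
          · rw [Finset.insert_eq_of_mem]
            have := Finset.mem_range.1 hj
            exact Finset.mem_union_left _ (Finset.mem_Icc.2 (by omega))
        · refine tsum_congr fun j => ?_
          rw [hins, show j + (k + 1) = j + 1 + k by omega, geo_add, mul_assoc]
      have hq : (1 - p) ^ k ≠ 0 := pow_ne_zero _ (sub_pos.2 hp.2).ne'
      have hFs' : F (S s) = step p (fun s => F (S s)) s := by
        apply mul_left_cancel₀ hq
        linarith
      rw [step_sub hp (fun s => hF1 (S s)) hG1]
      exact congrArg₂ _ hFs' hGs

/-- Decomposing according to the last `k ≤ N` at which a block ends. -/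
lemma renewal_bound {p : ℝ} (hp : p ∈ Set.Ioo (0 : ℝ) 1) {ν : Measure ℕ}
    [IsProbabilityMeasure ν] (hν : ∀ j, ν.real {j} = geo p j) {c : ℝ}
    (hc : ∀ k, c ≤ fillProb ν k) (N : ℕ) :
    (N + 1) * (c * (iidLaw ν).real {x | Avoids ∅ 0 N x}) ≤ 1 := by
  set D : ℕ → Set (ℕ → ℕ) := fun k => {x | Fills ∅ k x ∧ Avoids ∅ k N x} with hD
  have hDm : ∀ k, MeasurableSet (D k) := fun k =>
    (measurableSet_fills ∅ k).inter (measurableSet_avoids ∅ k N)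
  have hdisj : Set.PairwiseDisjoint (Finset.range (N + 1) : Set ℕ) D := by
    have hlt : ∀ i j, i < j → j < N + 1 → Disjoint (D i) (D j) := by
      intro i j hij hj
      rw [Set.disjoint_left]
      exact fun x hx hx' => hx.2 j (Finset.mem_Ioc.2 (by omega)) hx'.1
    intro i hi j hj hij
    simp only [Finset.coe_range, Set.mem_Iio] at hi hj
    rcases lt_or_gt_of_ne hij with h | h
    · exact hlt i j h hj
    · exact (hlt j i h hi).symm
  have hle : ∀ k ∈ Finset.range (N + 1),
      c * (iidLaw ν).real {x | Avoids ∅ 0 N x} ≤ (iidLaw ν).real (D k) := by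
    intro k hk
    obtain ⟨n, rfl⟩ := Nat.exists_eq_add_of_le (Nat.lt_succ_iff.1 (Finset.mem_range.1 hk))
    rw [hD, prob_fills_and_avoids hp hν, prob_avoids_Icc hp hν]
    refine mul_le_mul (hc k) (measureReal_mono ?_) measureReal_nonneg measureReal_nonneg
    intro x hx m hm
    exact hx m (Finset.Ioc_subset_Ioc_right (by omega) hm)
  calc (N + 1) * (c * (iidLaw ν).real {x | Avoids ∅ 0 N x})
      = ∑ k ∈ Finset.range (N + 1), c * (iidLaw ν).real {x | Avoids ∅ 0 N x} := by simp
    _ ≤ ∑ k ∈ Finset.range (N + 1), (iidLaw ν).real (D k) := Finset.sum_le_sum hle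
    _ = (iidLaw ν).real (⋃ k ∈ Finset.range (N + 1), D k) :=
        (measureReal_biUnion_finset hdisj fun k _ => hDm k).symm
    _ ≤ 1 := measureReal_le_one

/-! ### An integral formula for the renewal probabilities -/

/-- Let independent exponential clocks have rates `w j`, `j ∈ U`, and `a`. Up to the factor `a`,
this is the density at time `t` for the clock with rate `a` to ring after all others. -/
noncomputable def clockDensity (a : ℝ) (w : ℕ → ℝ) (U : Finset ℕ) (t : ℝ) : ℝ :=
  Real.exp (-a * t) * ∏ j ∈ U, (1 - Real.exp (-w j * t))

lemma continuous_clockDensity (a : ℝ) (w : ℕ → ℝ) (U : Finset ℕ) :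
    Continuous (clockDensity a w U) := by
  unfold clockDensity; fun_prop

lemma clock_factor_mem {w : ℕ → ℝ} {j : ℕ} (hw : 0 ≤ w j) {t : ℝ} (ht : 0 ≤ t) :
    1 - Real.exp (-w j * t) ∈ Set.Icc (0 : ℝ) 1 := by
  have h1 : Real.exp (-w j * t) ≤ 1 := Real.exp_le_one_iff.2 (by nlinarith)
  have h2 := Real.exp_pos (-w j * t)
  constructor <;> linarith

lemma clockDensity_nonneg {a : ℝ} {w : ℕ → ℝ} {U : Finset ℕ} (hw : ∀ j ∈ U, 0 ≤ w j) {t : ℝ}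
    (ht : 0 ≤ t) : 0 ≤ clockDensity a w U t :=
  mul_nonneg (Real.exp_pos _).le
    (Finset.prod_nonneg fun j hj => (clock_factor_mem (hw j hj) ht).1)

lemma clockDensity_le {a : ℝ} {w : ℕ → ℝ} {U : Finset ℕ} (hw : ∀ j ∈ U, 0 ≤ w j) {t : ℝ}
    (ht : 0 ≤ t) : clockDensity a w U t ≤ Real.exp (-a * t) :=
  mul_le_of_le_one_right (Real.exp_pos _).le
    (Finset.prod_le_one (fun j hj => (clock_factor_mem (hw j hj) ht).1)
      fun j hj => (clock_factor_mem (hw j hj) ht).2)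

lemma integrableOn_clockDensity {a : ℝ} (ha : 0 < a) {w : ℕ → ℝ} {U : Finset ℕ}
    (hw : ∀ j ∈ U, 0 ≤ w j) : IntegrableOn (clockDensity a w U) (Set.Ioi 0) := by
  refine Integrable.mono' (integrableOn_exp_mul_Ioi (neg_lt_zero.2 ha) 0)
    (continuous_clockDensity a w U).aestronglyMeasurable ?_
  filter_upwards [ae_restrict_mem measurableSet_Ioi] with t ht
  rw [Real.norm_eq_abs, abs_of_nonneg (clockDensity_nonneg hw (le_of_lt ht))]
  exact clockDensity_le hw (le_of_lt ht)

lemma integral_clockDensity_empty {a : ℝ} (ha : 0 < a) (w : ℕ → ℝ) :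
    a * ∫ t in Set.Ioi 0, clockDensity a w ∅ t = 1 := by
  simp only [clockDensity, Finset.prod_empty, mul_one]
  rw [integral_exp_mul_Ioi (neg_lt_zero.2 ha) 0]
  field_simp
  simp

lemma hasDerivAt_clockDensity (a : ℝ) (w : ℕ → ℝ) (U : Finset ℕ) (t : ℝ) :
    HasDerivAt (clockDensity a w U)
      (∑ j ∈ U, w j * clockDensity a w (U.erase j) t -
        (a + ∑ j ∈ U, w j) * clockDensity a w U t) t := by
  have h1 : HasDerivAt (fun t => Real.exp (-a * t)) (Real.exp (-a * t) * (-a)) t := by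
    simpa using ((hasDerivAt_id t).const_mul (-a)).exp
  have h2 : ∀ j, HasDerivAt (fun t => 1 - Real.exp (-w j * t))
      (w j * Real.exp (-w j * t)) t := by
    intro j
    have h : HasDerivAt (fun t => 1 - Real.exp (-w j * t))
        (-(Real.exp (-w j * t) * (-w j * 1))) t :=
      (((hasDerivAt_id t).const_mul (-w j)).exp).const_sub 1
    exact h.congr_deriv (by ring)
  have h3 := h1.mul (HasDerivAt.fun_finsetProd (u := U) fun j _ => h2 j)
  refine h3.congr_deriv ?_
  have h4 : ∀ j ∈ U, w j * clockDensity a w (U.erase j) t - w j * clockDensity a w U t =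
      Real.exp (-a * t) *
        ((∏ i ∈ U.erase j, (1 - Real.exp (-w i * t))) • (w j * Real.exp (-w j * t))) := by
    intro j hj
    simp only [clockDensity, smul_eq_mul]
    rw [← Finset.mul_prod_erase U _ hj]
    ring
  rw [Finset.mul_sum, ← Finset.sum_congr rfl h4, Finset.sum_sub_distrib, ← Finset.sum_mul]
  simp only [clockDensity]
  ring

/-- The first ring among all clocks: the recursion over the set of clocks still to ring. -/
lemma integral_clockDensity_recursion {a : ℝ} (ha : 0 < a) {w : ℕ → ℝ} {U : Finset ℕ}
    (hw : ∀ j ∈ U, 0 ≤ w j) (hU : U.Nonempty) :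
    (a + ∑ j ∈ U, w j) * ∫ t in Set.Ioi 0, clockDensity a w U t =
      ∑ j ∈ U, w j * ∫ t in Set.Ioi 0, clockDensity a w (U.erase j) t := by
  have hint : ∀ j ∈ U, IntegrableOn (fun t => w j * clockDensity a w (U.erase j) t)
      (Set.Ioi 0) := fun j _ =>
    (integrableOn_clockDensity ha fun i hi => hw i (Finset.mem_of_mem_erase hi)).const_mul _
  have hint' := (integrableOn_clockDensity ha hw).const_mul (a + ∑ j ∈ U, w j)
  have hlim : Tendsto (clockDensity a w U) atTop (𝓝 0) := by
    have he : Tendsto (fun t : ℝ => Real.exp (-a * t)) atTop (𝓝 0) :=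
      Real.tendsto_exp_atBot.comp (tendsto_id.const_mul_atTop_of_neg (neg_lt_zero.2 ha))
    refine squeeze_zero' ?_ ?_ he
    · filter_upwards [eventually_ge_atTop 0] with t ht using clockDensity_nonneg hw ht
    · filter_upwards [eventually_ge_atTop 0] with t ht using clockDensity_le hw ht
  have h := integral_Ioi_of_hasDerivAt_of_tendsto' (a := 0)
    (fun t _ => hasDerivAt_clockDensity a w U t)
    ((integrable_finsetSum U hint).sub hint') hlim
  have h0 : clockDensity a w U 0 = 0 := by
    obtain ⟨j, hj⟩ := hU
    simp only [clockDensity]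
    rw [Finset.prod_eq_zero hj (by simp), mul_zero]
  rw [integral_sub (integrable_finsetSum U hint) hint', integral_finsetSum U hint, h0,
    integral_const_mul] at h
  simp only [integral_const_mul] at h
  linarith

lemma sum_Icc_geo (p : ℝ) (k : ℕ) : ∑ j ∈ Finset.Icc 1 k, geo p j = 1 - (1 - p) ^ k := by
  rw [← sum_range_geo, Finset.sum_range_eq_add_Ico _ (by omega)]
  simp only [geo, zero_add]
  rfl

/-- Replacing the draws by the rings of independent exponential clocks, the values `1, …, k`
appear first if their clocks ring before the one, with rate `(1 - p) ^ k`, of all other values. -/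
lemma fillProb_eq {p : ℝ} (hp : p ∈ Set.Ioo (0 : ℝ) 1) {ν : Measure ℕ}
    [IsProbabilityMeasure ν] (hν : ∀ j, ν.real {j} = geo p j) (k : ℕ) :
    fillProb ν k = (1 - p) ^ k *
      ∫ t in Set.Ioi 0, clockDensity ((1 - p) ^ k) (geo p) (Finset.Icc 1 k) t := by
  set a := (1 - p) ^ k with ha_def
  have ha : 0 < a := pow_pos (sub_pos.2 hp.2) k
  have hw : ∀ j, 0 ≤ geo p j := geo_nonneg hp
  set J : Finset ℕ → ℝ := fun U => a * ∫ t in Set.Ioi 0, clockDensity a (geo p) U t with hJ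
  have hJ1 : ∀ U, |J U| ≤ 1 := by
    intro U
    have hnn : 0 ≤ ∫ t in Set.Ioi 0, clockDensity a (geo p) U t :=
      setIntegral_nonneg measurableSet_Ioi fun t ht =>
        clockDensity_nonneg (fun j _ => hw j) (le_of_lt ht)
    rw [abs_of_nonneg (mul_nonneg ha.le hnn), ← integral_clockDensity_empty ha (geo p)]
    refine mul_le_mul_of_nonneg_left ?_ ha.le
    refine setIntegral_mono_on (integrableOn_clockDensity ha fun j _ => hw j)
      (integrableOn_clockDensity ha fun j _ => hw j) measurableSet_Ioi fun t ht => ?_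
    refine (clockDensity_le (fun j _ => hw j) (le_of_lt ht)).trans_eq ?_
    simp [clockDensity]
  set R : Finset ℕ → ℝ := fun s => (iidLaw ν).real {x | Fills s k x} with hR
  set G : Finset ℕ → ℝ := fun s => if s ⊆ Finset.Icc 1 k then J (Finset.Icc 1 k \ s) else 0
    with hG
  have hG1 : ∀ s, |G s| ≤ 1 := by
    intro s
    simp only [hG]
    split_ifs
    · exact hJ1 _
    · simp
  have h0 := eq_zero_of_step hp (N := k) (d := fun s => R s - G s) ?_ ?_ ∅ (by simp)
  · have := sub_eq_zero.1 h0
    simpa [fillProb, hR, hG, hJ] using this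
  · intro s _ j hj
    have hno : ¬ insert j s ⊆ Finset.Icc 1 k := fun h => by
      have := Finset.mem_Icc.1 (h (Finset.mem_insert_self j s)); omega
    have hno' : ∀ x, ¬ Fills (insert j s) k x := fun x hx => hno hx.subset
    simp [hR, hG, hno, hno']
  · intro s hs
    by_cases hsk : s = Finset.Icc 1 k
    · left
      subst hsk
      simp [hR, hG, fills_self, hJ, integral_clockDensity_empty ha]
    · right
      rw [step_sub hp (fun s => abs_prob_le _ _) hG1]
      congr 1
      · exact prob_step hν (E := fun s => {x | Fills s k x}) (measurableSet_fills s k)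
          fun j y => fills_consSeq hsk j y
      set U := Finset.Icc 1 k \ s with hU
      have hUne : U.Nonempty := by
        rw [Finset.nonempty_iff_ne_empty]
        intro h
        exact hsk (hs.antisymm (Finset.sdiff_eq_empty_iff_subset.1 h))
      have hrec := integral_clockDensity_recursion ha (fun j (_ : j ∈ U) => hw j) hUne
      have htot : ∑ j ∈ U, geo p j + ∑ j ∈ s, geo p j = 1 - a := by
        rw [hU, Finset.sum_sdiff hs, sum_Icc_geo]
      have hstep : step p G s = ∑ j ∈ U, geo p j * J (U.erase j) + ∑ j ∈ s, geo p j * J U := by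
        unfold step
        rw [tsum_eq_sum (s := Finset.Icc 1 k), ← Finset.sum_sdiff hs]
        · congr 1
          · refine Finset.sum_congr rfl fun j hj => ?_
            simp only [hG]
            rw [if_pos (Finset.insert_subset (Finset.mem_sdiff.1 hj).1 hs), Finset.sdiff_insert]
          · refine Finset.sum_congr rfl fun j hj => ?_
            simp only [hG]
            rw [Finset.insert_eq_of_mem hj, if_pos hs]
        · intro j hj
          simp only [hG]
          rw [if_neg fun h => hj (h (Finset.mem_insert_self j s)), mul_zero]
      have hGs : G s = J U := by simp only [hG]; rw [if_pos hs]
      rw [hGs, hstep, ← Finset.sum_mul, eq_sub_of_add_eq' htot]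
      have : ∑ j ∈ U, geo p j * J (U.erase j) = (a + ∑ j ∈ U, geo p j) * J U := by
        simp only [hJ]
        rw [mul_left_comm, hrec, Finset.mul_sum]
        exact Finset.sum_congr rfl fun j _ => by ring
      rw [this]
      ring

/-! ### The rate function -/

/-- The integrand `-log (1 - 2 ^ (-e ^ y))` in the constant `b`. -/
noncomputable def rate (y : ℝ) : ℝ := -Real.log (1 - (2 : ℝ) ^ (-Real.exp y))

lemma two_rpow_neg_exp (y : ℝ) :
    (2 : ℝ) ^ (-Real.exp y) = Real.exp (-(Real.log 2 * Real.exp y)) := by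
  rw [Real.rpow_def_of_pos two_pos, mul_neg]

lemma log_two_pos : 0 < Real.log 2 := Real.log_pos one_lt_two

lemma one_sub_two_rpow_pos (y : ℝ) : 0 < 1 - (2 : ℝ) ^ (-Real.exp y) := by
  rw [two_rpow_neg_exp, sub_pos, Real.exp_lt_one_iff]
  have := mul_pos log_two_pos (Real.exp_pos y)
  linarith

lemma exp_neg_rate (y : ℝ) :
    Real.exp (-rate y) = 1 - Real.exp (-(Real.log 2 * Real.exp y)) := by
  rw [rate, neg_neg, Real.exp_log (one_sub_two_rpow_pos y), two_rpow_neg_exp]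

lemma rate_nonneg (y : ℝ) : 0 ≤ rate y := by
  have h := Real.log_nonpos (one_sub_two_rpow_pos y).le
    (by linarith [Real.rpow_pos_of_pos two_pos (-Real.exp y)])
  unfold rate; linarith

lemma rate_antitone : Antitone rate := by
  intro x y h
  refine neg_le_neg (Real.log_le_log (one_sub_two_rpow_pos x) ?_)
  have : (2 : ℝ) ^ (-Real.exp y) ≤ 2 ^ (-Real.exp x) :=
    Real.rpow_le_rpow_of_exponent_le one_le_two (neg_le_neg (Real.exp_le_exp.2 h))
  linarith

lemma rate_zero : rate 0 = Real.log 2 := by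
  rw [rate, Real.exp_zero, Real.rpow_neg_one, show (1 : ℝ) - 2⁻¹ = 2⁻¹ by norm_num, Real.log_inv,
    neg_neg]

lemma intervalIntegrable_rate (a c : ℝ) : IntervalIntegrable rate volume a c :=
  rate_antitone.intervalIntegrable

lemma integrableOn_rate : IntegrableOn rate (Set.Ioi 0) := by
  refine Integrable.mono' (g := fun y => 2 * Real.exp (-Real.log 2 * y))
    ((integrableOn_exp_mul_Ioi (neg_lt_zero.2 log_two_pos) 0).const_mul 2)
    rate_antitone.measurable.aestronglyMeasurable ?_
  filter_upwards [ae_restrict_mem measurableSet_Ioi] with y hy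
  rw [Real.norm_eq_abs, abs_of_nonneg (rate_nonneg y)]
  have hy : 0 < y := hy
  set z := (2 : ℝ) ^ (-Real.exp y) with hz
  have hz0 : 0 < z := Real.rpow_pos_of_pos two_pos _
  have hz1 : z ≤ 1 / 2 := by
    calc z ≤ (2 : ℝ) ^ (-1 : ℝ) := Real.rpow_le_rpow_of_exponent_le one_le_two
          (neg_le_neg (Real.one_le_exp hy.le))
      _ = 1 / 2 := by rw [Real.rpow_neg_one]; norm_num
  have hz2 : z ≤ Real.exp (-Real.log 2 * y) := by
    rw [hz, two_rpow_neg_exp]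
    refine Real.exp_le_exp.2 ?_
    have := Real.add_one_le_exp y
    nlinarith [log_two_pos]
  have hlog := Real.one_sub_inv_le_log_of_pos (one_sub_two_rpow_pos y)
  have h1 : (1 - z)⁻¹ ≤ 1 + 2 * z := by
    rw [inv_le_iff_one_le_mul₀ (by linarith)]
    nlinarith
  change -Real.log (1 - z) ≤ _
  linarith

lemma b_eq : b = Real.log 2 + ∫ y in Set.Ioi (0 : ℝ), rate y := by
  simp only [b, rate, integral_neg, sub_eq_add_neg]

lemma integral_rate_le (L : ℝ) (hL : 0 ≤ L) :
    ∫ y in (0 : ℝ)..L, rate y ≤ ∫ y in Set.Ioi (0 : ℝ), rate y := by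
  rw [intervalIntegral.integral_of_le hL]
  exact setIntegral_mono_set integrableOn_rate
    (Eventually.of_forall fun y => rate_nonneg y) Set.Ioc_subset_Ioi_self.eventuallyLE

/-- On either side of `0` the comparison is with the value `rate 0 = log 2`. -/
lemma neg_mul_log_two_le_integral (c : ℝ) : -c * Real.log 2 ≤ ∫ y in c..0, rate y := by
  rcases le_total c 0 with h | h
  · have := intervalIntegral.integral_mono_on h (intervalIntegrable_const (c := Real.log 2))
      (intervalIntegrable_rate c 0) fun x hx => rate_zero ▸ rate_antitone hx.2
    simpa using this
  · have := intervalIntegral.integral_mono_on h (intervalIntegrable_rate 0 c)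
      (intervalIntegrable_const (c := Real.log 2)) fun x hx => rate_zero ▸ rate_antitone hx.1
    rw [intervalIntegral.integral_symm]
    simp at this
    linarith

/-- The variational problem behind `b`: the minimum of `log 2 * e ^ c + ∫ y in c..∞, rate y` is
attained at `c = 0`, because the derivative `log 2 * e ^ c - rate c` changes its sign there.
The integral is truncated to length `L`, which costs no more than replacing `b` by `β`. -/
lemma le_log_two_mul_exp_add_integral {A L β : ℝ} (hA : 0 ≤ A) (hL : 2 * A ≤ L)
    (hβ : β ≤ Real.log 2 + ∫ y in (0 : ℝ)..A, rate y) (hβA : β ≤ A * Real.log 2) (c : ℝ) :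
    β ≤ Real.log 2 * Real.exp c + ∫ y in c..c + L, rate y := by
  have hpos : ∀ u v, u ≤ v → 0 ≤ ∫ y in u..v, rate y := fun u v huv =>
    intervalIntegral.integral_nonneg huv fun y _ => rate_nonneg y
  have hsplit : ∀ u v w, ∫ y in u..w, rate y = (∫ y in u..v, rate y) + ∫ y in v..w, rate y :=
    fun u v w => (intervalIntegral.integral_add_adjacent_intervals
      (intervalIntegrable_rate u v) (intervalIntegrable_rate v w)).symm
  have hexp := Real.add_one_le_exp c
  have hl := log_two_pos
  rcases lt_or_ge c (-A) with h1 | h1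
  · have h2 := hsplit c (c + A) (c + L)
    have h3 := hpos (c + A) (c + L) (by linarith)
    have h4 := intervalIntegral.integral_mono_on (a := c) (b := c + A) (by linarith)
      (intervalIntegrable_const (c := Real.log 2)) (intervalIntegrable_rate c (c + A))
      fun x hx => rate_zero ▸ rate_antitone (show x ≤ 0 by linarith [hx.2])
    simp at h4
    have := mul_pos hl (Real.exp_pos c)
    linarith
  rcases le_or_gt c A with h2 | h2
  · have h3 := hsplit c A (c + L)
    have h4 := hpos A (c + L) (by linarith)
    have h5 := hsplit c 0 A
    have h6 := neg_mul_log_two_le_integral c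
    nlinarith
  · have h3 := hpos c (c + L) (by linarith)
    have h4 := neg_mul_log_two_le_integral A
    rw [intervalIntegral.integral_symm] at h4
    nlinarith

lemma sum_rate_le {l : ℝ} (hl : 0 < l) (k : ℕ) :
    ∑ i ∈ Finset.range k, rate (l * (i + 1)) ≤ l⁻¹ * ∫ y in Set.Ioi (0 : ℝ), rate y := by
  have hanti : Antitone fun x => rate (l * x) := fun x y h =>
    rate_antitone (mul_le_mul_of_nonneg_left h hl.le)
  have h := (hanti.antitoneOn (Set.Icc (0 : ℝ) (0 + k))).sum_le_integral
  rw [intervalIntegral.integral_comp_mul_left _ hl.ne', smul_eq_mul] at h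
  simp only [zero_add, mul_zero, Nat.cast_add, Nat.cast_one] at h
  exact h.trans (mul_le_mul_of_nonneg_left (integral_rate_le _ (by positivity))
    (inv_nonneg.2 hl.le))

lemma integral_le_sum_rate {l : ℝ} (hl : 0 < l) (c : ℝ) (k : ℕ) :
    l⁻¹ * ∫ y in c..c + l * k, rate y ≤ ∑ i ∈ Finset.range k, rate (c + l * i) := by
  have hanti : Antitone fun x => rate (c + l * x) := fun x y h =>
    rate_antitone (add_le_add_right (mul_le_mul_of_nonneg_left h hl.le) c)
  have h := (hanti.antitoneOn (Set.Icc (0 : ℝ) (0 + k))).integral_le_sum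
  rw [intervalIntegral.integral_comp_add_mul _ hl.ne', smul_eq_mul] at h
  simpa only [zero_add, mul_zero, add_zero] using h

/-! ### Bounds for the renewal probabilities -/

/-- The logarithmic spacing of the geometric weights. -/
noncomputable def spacing (p : ℝ) : ℝ := -Real.log (1 - p)

lemma exp_spacing {p : ℝ} (hp : p ∈ Set.Ioo (0 : ℝ) 1) : Real.exp (-spacing p) = 1 - p := by
  rw [spacing, neg_neg, Real.exp_log (sub_pos.2 hp.2)]

lemma le_spacing {p : ℝ} (hp : p ∈ Set.Ioo (0 : ℝ) 1) : p ≤ spacing p := by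
  have := Real.log_le_sub_one_of_pos (sub_pos.2 hp.2)
  unfold spacing; linarith

lemma spacing_le {p : ℝ} (hp : p ∈ Set.Ioo (0 : ℝ) 1) : spacing p ≤ p / (1 - p) := by
  have h := sub_pos.2 hp.2
  have := Real.one_sub_inv_le_log_of_pos h
  have h2 : p / (1 - p) = (1 - p)⁻¹ - 1 := by field_simp; ring
  unfold spacing; linarith

/-- On the logarithmic scale, the density is governed by a Riemann sum of `rate`. -/
lemma clockDensity_geo_eq {p : ℝ} (hp : p ∈ Set.Ioo (0 : ℝ) 1) (k : ℕ) {t c : ℝ}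
    (hc : p * (1 - p) ^ k * t = Real.log 2 * Real.exp c) :
    clockDensity ((1 - p) ^ k) (geo p) (Finset.Icc 1 k) t =
      Real.exp (-((1 - p) ^ k * t) -
        ∑ i ∈ Finset.range k, rate (c + spacing p * (i + 1))) := by
  rw [clockDensity, Real.exp_sub, div_eq_mul_inv, ← Real.exp_neg, neg_mul, ← Finset.sum_neg_distrib,
    Real.exp_sum]
  congr 1
  have h1 : ∏ j ∈ Finset.Icc 1 k, (1 - Real.exp (-geo p j * t)) =
      ∏ i ∈ Finset.range k, (1 - Real.exp (-geo p (i + 1) * t)) := by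
    rw [Finset.range_eq_Ico, Finset.prod_Ico_add' (fun j => 1 - Real.exp (-geo p j * t))]
    rfl
  rw [h1, ← Finset.prod_range_reflect]
  refine Finset.prod_congr rfl fun i hi => ?_
  have hi := Finset.mem_range.1 hi
  rw [exp_neg_rate, Real.exp_add, ← mul_assoc, ← hc, geo]
  congr 3
  have h2 : (1 - p) ^ k * Real.exp (spacing p * (i + 1)) = (1 - p) ^ (k - 1 - i) := by
    have h3 : Real.exp (spacing p * (i + 1)) * (1 - p) ^ (i + 1) = 1 := by
      rw [← exp_spacing hp, ← Real.exp_nat_mul, ← Real.exp_add, Real.exp_eq_one_iff]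
      push_cast; ring
    have h4 : (1 - p) ^ k = (1 - p) ^ (k - 1 - i) * (1 - p) ^ (i + 1) := by
      rw [← pow_add]; congr 1; omega
    rw [h4, mul_assoc, mul_comm ((1 - p) ^ (i + 1)), h3, mul_one]
  rw [← h2]
  ring

/-- The integral over `(1 - p) ^ k * t ∈ [log 2 / p, log 2 / p + 1]` is large enough. -/
lemma le_fillProb {p : ℝ} (hp : p ∈ Set.Ioo (0 : ℝ) 1) {ν : Measure ℕ}
    [IsProbabilityMeasure ν] (hν : ∀ j, ν.real {j} = geo p j) (k : ℕ) :
    Real.exp (-(b / p) - 1) ≤ fillProb ν k := by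
  have hp0 := hp.1
  set a := (1 - p) ^ k with ha_def
  have ha : 0 < a := pow_pos (sub_pos.2 hp.2) k
  have hl : 0 < spacing p := hp0.trans_le (le_spacing hp)
  rw [fillProb_eq hp hν, ← ha_def]
  set t₀ := Real.log 2 / (p * a) with ht₀
  have ht₀pos : 0 < t₀ := div_pos log_two_pos (mul_pos hp0 ha)
  have hle : t₀ ≤ t₀ + a⁻¹ := by have := inv_pos.2 ha; linarith
  have hpt : ∀ t ∈ Set.Icc t₀ (t₀ + a⁻¹), Real.exp (-(b / p) - 1) ≤
      clockDensity a (geo p) (Finset.Icc 1 k) t := by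
    intro t ht
    have htpos : 0 < t := ht₀pos.trans_le ht.1
    have h1 : 1 ≤ p * a * t / Real.log 2 := by
      rw [le_div_iff₀ log_two_pos, one_mul]
      have := (div_le_iff₀ (mul_pos hp0 ha)).1 ht.1
      linarith
    rw [ha_def, clockDensity_geo_eq hp k (c := Real.log (p * a * t / Real.log 2)) (by
      rw [Real.exp_log (by linarith), mul_div_cancel₀ _ log_two_pos.ne'])]
    refine Real.exp_le_exp.2 ?_
    have h2 : ∑ i ∈ Finset.range k,
        rate (Real.log (p * a * t / Real.log 2) + spacing p * (i + 1)) ≤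
        ∑ i ∈ Finset.range k, rate (spacing p * (i + 1)) :=
      Finset.sum_le_sum fun i _ => rate_antitone (by linarith [Real.log_nonneg h1])
    have hI : 0 ≤ ∫ y in Set.Ioi (0 : ℝ), rate y := integral_nonneg rate_nonneg
    have h3 : (spacing p)⁻¹ * ∫ y in Set.Ioi (0 : ℝ), rate y ≤
        p⁻¹ * ∫ y in Set.Ioi (0 : ℝ), rate y :=
      mul_le_mul_of_nonneg_right (inv_anti₀ hp0 (le_spacing hp)) hI
    have h4 : a * t ≤ Real.log 2 / p + 1 := by
      have := mul_le_mul_of_nonneg_left ht.2 ha.le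
      have e : a * (t₀ + a⁻¹) = Real.log 2 / p + 1 := by rw [ht₀]; field_simp
      linarith
    have h5 : b / p = Real.log 2 / p + p⁻¹ * ∫ y in Set.Ioi (0 : ℝ), rate y := by
      rw [b_eq]; ring
    have := sum_rate_le hl k
    linarith
  have hint := integrableOn_clockDensity ha (w := geo p) (U := Finset.Icc 1 k)
    fun j _ => geo_nonneg hp j
  have h6 : a⁻¹ * Real.exp (-(b / p) - 1) ≤
      ∫ t in t₀..t₀ + a⁻¹, clockDensity a (geo p) (Finset.Icc 1 k) t := by
    have := intervalIntegral.integral_mono_on (μ := volume) hle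
      (intervalIntegrable_const (c := Real.exp (-(b / p) - 1)))
      ((continuous_clockDensity a (geo p) (Finset.Icc 1 k)).intervalIntegrable _ _) hpt
    simpa using this
  have h7 : ∫ t in t₀..t₀ + a⁻¹, clockDensity a (geo p) (Finset.Icc 1 k) t ≤
      ∫ t in Set.Ioi 0, clockDensity a (geo p) (Finset.Icc 1 k) t := by
    rw [intervalIntegral.integral_of_le hle]
    refine setIntegral_mono_set hint ?_
      (Set.Ioc_subset_Ioi_self.trans (Set.Ioi_subset_Ioi ht₀pos.le)).eventuallyLE
    filter_upwards [ae_restrict_mem measurableSet_Ioi] with t ht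
    exact clockDensity_nonneg (fun j _ => geo_nonneg hp j) (le_of_lt ht)
  calc Real.exp (-(b / p) - 1) = a * (a⁻¹ * Real.exp (-(b / p) - 1)) := by
        rw [mul_inv_cancel_left₀ ha.ne']
    _ ≤ _ := mul_le_mul_of_nonneg_left (h6.trans h7) ha.le

lemma fillProb_le_of_density_le {p : ℝ} (hp : p ∈ Set.Ioo (0 : ℝ) 1) {ν : Measure ℕ}
    [IsProbabilityMeasure ν] (hν : ∀ j, ν.real {j} = geo p j) (k : ℕ) {C r : ℝ} (hr : 0 < r)
    (h : ∀ t, 0 < t → clockDensity ((1 - p) ^ k) (geo p) (Finset.Icc 1 k) t ≤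
      C * Real.exp (-(r * (1 - p) ^ k) * t)) :
    fillProb ν k ≤ C / r := by
  have ha : 0 < (1 - p) ^ k := pow_pos (sub_pos.2 hp.2) k
  have hneg : -(r * (1 - p) ^ k) < 0 := neg_lt_zero.2 (mul_pos hr ha)
  rw [fillProb_eq hp hν]
  have h1 := setIntegral_mono_on (integrableOn_clockDensity ha fun j _ => geo_nonneg hp j)
    ((integrableOn_exp_mul_Ioi hneg 0).const_mul C) measurableSet_Ioi h
  rw [integral_const_mul, integral_exp_mul_Ioi hneg] at h1
  refine (mul_le_mul_of_nonneg_left h1 ha.le).trans_eq ?_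
  simp only [mul_zero, Real.exp_zero]
  field_simp

/-- The exponential bound, valid for all `k` beyond a multiple of `1 / p`. -/
lemma fillProb_le_exp {p : ℝ} (hp : p ∈ Set.Ioo (0 : ℝ) 1) {ν : Measure ℕ}
    [IsProbabilityMeasure ν] (hν : ∀ j, ν.real {j} = geo p j) {k : ℕ} {A β : ℝ} (hA : 0 ≤ A)
    (hk : 2 * A ≤ p * k) (hβ0 : 0 ≤ β)
    (hβ : β ≤ Real.log 2 + ∫ y in (0 : ℝ)..A, rate y) (hβA : β ≤ A * Real.log 2) :
    fillProb ν k ≤ Real.exp (-((1 - p) ^ 3 * β / p)) / p := by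
  have hp0 := hp.1
  have hq : 0 < 1 - p := sub_pos.2 hp.2
  set l := spacing p with hl_def
  have hpl : p ≤ l := le_spacing hp
  have hl : 0 < l := hp0.trans_le hpl
  refine fillProb_le_of_density_le hp hν k hp0 fun t ht => ?_
  set a := (1 - p) ^ k with ha_def
  have ha : 0 < a := pow_pos hq k
  have hx : 0 < p * a * t / Real.log 2 := by have := log_two_pos; positivity
  set c := Real.log (p * a * t / Real.log 2) with hc_def
  have hc : p * a * t = Real.log 2 * Real.exp c := by
    rw [hc_def, Real.exp_log hx, mul_div_cancel₀ _ log_two_pos.ne']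
  rw [ha_def, clockDensity_geo_eq hp k hc, ← ha_def, ← Real.exp_add]
  refine Real.exp_le_exp.2 ?_
  have hV := le_log_two_mul_exp_add_integral hA
    (show 2 * A ≤ l * k from hk.trans (mul_le_mul_of_nonneg_right hpl (by positivity)))
    hβ hβA (c + l)
  set I := ∫ y in (c + l)..(c + l + l * k), rate y with hI
  have hI0 : 0 ≤ I := intervalIntegral.integral_nonneg
    (by have : 0 ≤ l * k := by positivity
        linarith) fun y _ => rate_nonneg y
  have hsum : l⁻¹ * I ≤ ∑ i ∈ Finset.range k, rate (c + l * (i + 1)) := by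
    refine (integral_le_sum_rate hl (c + l) k).trans_eq ?_
    exact Finset.sum_congr rfl fun i _ => by ring_nf
  have hexp : (1 - p) * (Real.log 2 * Real.exp (c + l)) = p * a * t := by
    rw [hc, Real.exp_add, ← exp_spacing hp, ← hl_def, Real.exp_neg]
    field_simp
  -- One factor `1 - p` is lost to the shift of `c`, one to keep `p * a * t` for the integral,
  -- and one to `spacing p ≤ p / (1 - p)`.
  have hpinv : l⁻¹ ≤ p⁻¹ := inv_anti₀ hp0 hpl
  have hE0 : 0 ≤ Real.log 2 * Real.exp (c + l) :=
    (mul_pos log_two_pos (Real.exp_pos _)).le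
  have h1 : (1 - p) ^ 2 * l⁻¹ * (Real.log 2 * Real.exp (c + l)) ≤ (1 - p) * (a * t) := by
    have e : (1 - p) * (a * t) =
        (1 - p) ^ 2 * p⁻¹ * (Real.log 2 * Real.exp (c + l)) := by
      have : a * t = p⁻¹ * ((1 - p) * (Real.log 2 * Real.exp (c + l))) := by
        rw [hexp]; field_simp
      rw [this]; ring
    rw [e]
    gcongr
  have h2 : (1 - p) ^ 2 * l⁻¹ * I ≤ l⁻¹ * I := by
    have h : (1 - p) ^ 2 ≤ 1 := pow_le_one₀ hq.le (by linarith)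
    have := mul_le_mul_of_nonneg_right h (mul_nonneg (inv_nonneg.2 hl.le) hI0)
    linarith
  have h3 : (1 - p) ^ 3 * β / p ≤ (1 - p) ^ 2 * l⁻¹ * β := by
    have h : (1 - p) / p ≤ l⁻¹ := by
      rw [← inv_div]; exact inv_anti₀ hl (spacing_le hp)
    have e : (1 - p) ^ 3 * β / p = (1 - p) ^ 2 * ((1 - p) / p) * β := by ring
    rw [e]
    gcongr
  have h4 : (1 - p) ^ 2 * l⁻¹ * β ≤
      (1 - p) ^ 2 * l⁻¹ * (Real.log 2 * Real.exp (c + l) + I) := by gcongr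
  rw [mul_add] at h4
  nlinarith

lemma clock_factor_le (x : ℝ) : 1 - Real.exp (-x) ≤ x := by
  have := Real.add_one_le_exp (-x); linarith

lemma fillProb_one_le {p : ℝ} (hp : p ∈ Set.Ioo (0 : ℝ) 1) {ν : Measure ℕ}
    [IsProbabilityMeasure ν] (hν : ∀ j, ν.real {j} = geo p j) :
    fillProb ν 1 ≤ 4 * p / (1 - p) := by
  have hp0 := hp.1
  have hq : 0 < 1 - p := sub_pos.2 hp.2
  refine (fillProb_le_of_density_le hp hν 1 (C := 2 * p / (1 - p)) (r := 1 / 2) (by norm_num)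
    fun t ht => ?_).trans_eq (by ring)
  have h1 := clock_factor_le (p * t)
  have h2 := Real.add_one_le_exp ((1 - p) * t / 2)
  have e : Real.exp (-(1 - p) * t) * Real.exp ((1 - p) * t / 2) =
      Real.exp (-(1 / 2 * (1 - p)) * t) := by
    rw [← Real.exp_add]; congr 1; ring
  simp only [clockDensity, pow_one, Finset.Icc_self, Finset.prod_singleton, geo, pow_zero, mul_one]
  rw [← e, neg_mul p t]
  calc Real.exp (-(1 - p) * t) * (1 - Real.exp (-(p * t)))
      ≤ Real.exp (-(1 - p) * t) * (p * t) := by gcongr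
    _ = Real.exp (-(1 - p) * t) * (2 * p / (1 - p) * ((1 - p) * t / 2)) := by
        field_simp
    _ ≤ Real.exp (-(1 - p) * t) * (2 * p / (1 - p) * Real.exp ((1 - p) * t / 2)) := by
        gcongr; linarith
    _ = _ := by ring

/-- Keeping only the two largest of the `k` clock factors. -/
lemma fillProb_le_sq {p : ℝ} (hp : p ∈ Set.Ioo (0 : ℝ) 1) {ν : Measure ℕ}
    [IsProbabilityMeasure ν] (hν : ∀ j, ν.real {j} = geo p j) {k : ℕ} (hk : 2 ≤ k) :
    fillProb ν k ≤ 16 * p ^ 2 / (1 - p) ^ 3 := by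
  have hp0 := hp.1
  have hq : 0 < 1 - p := sub_pos.2 hp.2
  obtain ⟨m, rfl⟩ := Nat.exists_eq_add_of_le' hk
  refine (fillProb_le_of_density_le hp hν (m + 2) (C := 8 * p ^ 2 / (1 - p) ^ 3) (r := 1 / 2)
    (by norm_num) fun t ht => ?_).trans_eq (by ring)
  set a := (1 - p) ^ (m + 2) with ha_def
  have ha : 0 < a := pow_pos hq _
  have hmem : ∀ j, 1 - Real.exp (-geo p j * t) ∈ Set.Icc (0 : ℝ) 1 := fun j =>
    clock_factor_mem (geo_nonneg hp j) ht.le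
  have hfac : ∀ j, 1 - Real.exp (-geo p j * t) ≤ geo p j * t := fun j => by
    rw [neg_mul]; exact clock_factor_le _
  have h1 : ∏ j ∈ Finset.Icc 1 (m + 2), (1 - Real.exp (-geo p j * t)) ≤
      (geo p (m + 1) * t) * (geo p (m + 2) * t) := by
    rw [Finset.prod_Icc_succ_top (by omega), Finset.prod_Icc_succ_top (by omega)]
    have h := Finset.prod_le_one (s := Finset.Icc 1 m) (fun j _ => (hmem j).1)
      fun j _ => (hmem j).2
    have h' := mul_nonneg (geo_nonneg hp (m + 1)) ht.le
    refine mul_le_mul ?_ (hfac _) (hmem _).1 h'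
    exact (mul_le_of_le_one_left (hmem _).1 h).trans (hfac _)
  have h2 := Real.quadratic_le_exp_of_nonneg (show 0 ≤ a * t / 2 by positivity)
  have e : Real.exp (-a * t) * Real.exp (a * t / 2) = Real.exp (-(1 / 2 * a) * t) := by
    rw [← Real.exp_add]; congr 1; ring
  rw [clockDensity, ← e]
  calc Real.exp (-a * t) * ∏ j ∈ Finset.Icc 1 (m + 2), (1 - Real.exp (-geo p j * t))
      ≤ Real.exp (-a * t) * ((geo p (m + 1) * t) * (geo p (m + 2) * t)) := by gcongr
    _ = Real.exp (-a * t) * (8 * p ^ 2 / (1 - p) ^ 3 * ((a * t / 2) ^ 2 / 2)) := by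
        simp only [geo, ha_def]
        field_simp
        ring
    _ ≤ Real.exp (-a * t) * (8 * p ^ 2 / (1 - p) ^ 3 * Real.exp (a * t / 2)) := by
        have : 0 ≤ a * t / 2 := by positivity
        gcongr; linarith
    _ = _ := by ring

/-! ### Early and late first blocks -/

lemma real_singleton_eq_geo {p : ℝ} (hp : p ∈ Set.Ioo (0 : ℝ) 1) {ν : Measure ℕ}
    [IsProbabilityMeasure ν]
    (h : ∀ j, 1 ≤ j → ν {j} = ENNReal.ofReal (p * (1 - p) ^ (j - 1))) (j : ℕ) :
    ν.real {j} = geo p j := by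
  have hpos : ∀ j, 1 ≤ j → ν.real {j} = geo p j := by
    intro j hj
    obtain ⟨j, rfl⟩ := Nat.exists_eq_add_of_le' hj
    rw [measureReal_def, h _ hj, Nat.add_sub_cancel]
    exact ENNReal.toReal_ofReal (geo_nonneg hp (j + 1))
  rcases Nat.eq_zero_or_pos j with rfl | hj
  · -- The probabilities of the positive integers already add up to `1`.
    have h1 : ∑' j, ν {j} = 1 := by
      have := lintegral_countable' (μ := ν) (fun _ : ℕ => (1 : ENNReal))
      simpa using this.symm
    have h2 : HasSum (fun j => ν.real {j}) 1 := by
      have := ENNReal.hasSum_toReal (f := fun j => ν {j}) (by rw [h1]; exact ENNReal.one_ne_top)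
      rwa [← ENNReal.tsum_toReal_eq fun j => measure_ne_top _ _, h1] at this
    have h3 := h2.sub (hasSum_geo hp)
    have h4 := hasSum_single (f := fun j => ν.real {j} - geo p j) 0 fun j hj => by
      rw [hpos j (Nat.one_le_iff_ne_zero.2 hj), sub_self]
    have := h4.unique h3
    linarith
  · exact hpos j hj

lemma exists_law {Ω : Type*} [MeasurableSpace Ω] {P : Measure Ω} [IsProbabilityMeasure P]
    {X : ℕ → Ω → ℕ} {p : ℝ} (hp : p ∈ Set.Ioo (0 : ℝ) 1) (hmeas : ∀ n, Measurable (X n))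
    (hindep : iIndepFun X P)
    (hgeo : ∀ n j : ℕ, 1 ≤ j → P {ω | X n ω = j} = ENNReal.ofReal (p * (1 - p) ^ (j - 1))) :
    ∃ (ν : Measure ℕ) (_ : IsProbabilityMeasure ν), (∀ j, ν.real {j} = geo p j) ∧
      P.map (fun ω n => X n ω) = iidLaw ν := by
  have hprob : ∀ n, IsProbabilityMeasure (P.map (X n)) := fun n =>
    Measure.isProbabilityMeasure_map (hmeas n).aemeasurable
  have hreal : ∀ n j, (P.map (X n)).real {j} = geo p j := fun n =>
    real_singleton_eq_geo hp fun j hj => by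
      rw [Measure.map_apply (hmeas n) (measurableSet_singleton j)]
      exact hgeo n j hj
  have heq : ∀ n, P.map (X n) = P.map (X 0) := fun n => by
    refine Measure.ext_of_singleton fun j => ?_
    rw [← measureReal_eq_measureReal_iff, hreal, hreal]
  refine ⟨P.map (X 0), hprob 0, hreal 0, ?_⟩
  rw [hindep.map_fun_eq_infinitePi_map hmeas, iidLaw]
  congr 1
  exact funext heq

/-- An upper bound, for suitable `A` and `β`, for the probability that the first block ends before `e ^ ((b - ε) / p)`. -/
noncomputable def earlyBound (A β ε p : ℝ) : ℝ :=
  4 * p / (1 - p) + (2 * A + p) * (16 * p) / (1 - p) ^ 3 +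
    Real.exp (3 * β) * (p⁻¹ * Real.exp (-(ε / 2) * p⁻¹))

lemma tendsto_inv_mul_exp {c : ℝ} (hc : 0 < c) :
    Tendsto (fun p : ℝ => p⁻¹ * Real.exp (-c * p⁻¹)) (𝓝[>] 0) (𝓝 0) := by
  have h := tendsto_rpow_mul_exp_neg_mul_atTop_nhds_zero 1 c hc
  simp only [Real.rpow_one] at h
  exact h.comp tendsto_inv_nhdsGT_zero

lemma tendsto_earlyBound (A β : ℝ) {ε : ℝ} (hε : 0 < ε) :
    Tendsto (earlyBound A β ε) (𝓝[>] 0) (𝓝 0) := by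
  have h1 : Tendsto (fun p : ℝ => 4 * p / (1 - p) + (2 * A + p) * (16 * p) / (1 - p) ^ 3)
      (𝓝[>] 0) (𝓝 0) := by
    have : ContinuousAt (fun p : ℝ => 4 * p / (1 - p) + (2 * A + p) * (16 * p) / (1 - p) ^ 3)
        0 := by
      fun_prop (disch := norm_num)
    have := this.tendsto.mono_left (nhdsWithin_le_nhds (s := Set.Ioi 0))
    simpa using this
  have h2 := (tendsto_inv_mul_exp (half_pos hε)).const_mul (Real.exp (3 * β))
  have h3 := h1.add h2
  rw [mul_zero, add_zero] at h3
  exact h3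

/-- The union bound over all `k`: there are few `k` of order `1 / p`, and `fillProb_le_sq` suffices
for them; the others are treated by `fillProb_le_exp`. -/
lemma prob_early_le {p : ℝ} (hp : p ∈ Set.Ioo (0 : ℝ) 1) {ν : Measure ℕ}
    [IsProbabilityMeasure ν] (hν : ∀ j, ν.real {j} = geo p j) {A β ε : ℝ} (hA : 0 ≤ A)
    (hβ0 : 0 ≤ β) (hβ : β ≤ Real.log 2 + ∫ y in (0 : ℝ)..A, rate y) (hβA : β ≤ A * Real.log 2)
    (hβε : b - ε / 2 ≤ β) :
    (iidLaw ν).real {x | ∃ k : ℕ, 1 ≤ k ∧ (k : ℝ) ≤ Real.exp ((b - ε) / p) ∧ Fills ∅ k x} ≤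
      earlyBound A β ε p := by
  have hp0 := hp.1
  have hq : 0 < 1 - p := sub_pos.2 hp.2
  set T := Real.exp ((b - ε) / p) with hT
  have hT0 : 0 ≤ T := (Real.exp_pos _).le
  set c₁ := 4 * p / (1 - p) with hc₁
  set c₂ := 16 * p ^ 2 / (1 - p) ^ 3 with hc₂
  set c₃ := Real.exp (-((1 - p) ^ 3 * β / p)) / p with hc₃
  have hc₂0 : 0 ≤ c₂ := by positivity
  have hc₃0 : 0 ≤ c₃ := by positivity
  set M := ⌊2 * A / p⌋₊ with hM
  have hM0 : (0 : ℝ) ≤ 2 * A / p := by positivity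
  have hsub : {x | ∃ k : ℕ, 1 ≤ k ∧ (k : ℝ) ≤ T ∧ Fills ∅ k x} ⊆
      ⋃ k ∈ Finset.Icc 1 ⌊T⌋₊, {x | Fills ∅ k x} := by
    rintro x ⟨k, h1, h2, h3⟩
    exact Set.mem_biUnion (Finset.mem_coe.2 (Finset.mem_Icc.2 ⟨h1, Nat.le_floor h2⟩)) h3
  have hterm : ∀ k ∈ Finset.Icc 1 ⌊T⌋₊, fillProb ν k ≤
      (if k ∈ ({1} : Finset ℕ) then c₁ else 0) +
        (if k ∈ Finset.Icc 1 (M + 1) then c₂ else 0) + c₃ := by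
    intro k hk
    have hk1 := (Finset.mem_Icc.1 hk).1
    rcases hk1.eq_or_lt with rfl | hk2
    · have := fillProb_one_le hp hν
      simp
      linarith
    rw [if_neg (by simp; omega)]
    by_cases hkM : k ≤ M + 1
    · rw [if_pos (Finset.mem_Icc.2 ⟨hk1, hkM⟩)]
      have := fillProb_le_sq hp hν hk2
      linarith
    · rw [if_neg fun h => hkM (Finset.mem_Icc.1 h).2]
      have h2 : 2 * A / p ≤ k := by
        have h3 := (Nat.lt_floor_add_one (2 * A / p)).le
        have h4 : ((M + 1 : ℕ) : ℝ) ≤ k := by exact_mod_cast (not_le.1 hkM).le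
        push_cast at h4
        linarith
      have := fillProb_le_exp hp hν hA (k := k) (by
        rw [div_le_iff₀ hp0] at h2; linarith) hβ0 hβ hβA
      linarith
  have hsum : ∑ k ∈ Finset.Icc 1 ⌊T⌋₊, fillProb ν k ≤ c₁ + (2 * A / p + 1) * c₂ + T * c₃ := by
    refine (Finset.sum_le_sum hterm).trans ?_
    rw [Finset.sum_add_distrib, Finset.sum_add_distrib]
    have hc₁0 : 0 ≤ c₁ := by positivity
    refine add_le_add (add_le_add ?_ ?_) ?_
    · rw [← Finset.sum_filter, Finset.sum_const, nsmul_eq_mul]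
      have : ((Finset.Icc 1 ⌊T⌋₊).filter (· ∈ ({1} : Finset ℕ))).card ≤ 1 := by
        refine (Finset.card_le_card (t := {1}) fun k hk => (Finset.mem_filter.1 hk).2).trans_eq ?_
        simp
      exact mul_le_of_le_one_left hc₁0 (by exact_mod_cast this)
    · rw [← Finset.sum_filter, Finset.sum_const, nsmul_eq_mul]
      have : ((Finset.Icc 1 ⌊T⌋₊).filter (· ∈ Finset.Icc 1 (M + 1))).card ≤ M + 1 := by
        refine (Finset.card_le_card (t := Finset.Icc 1 (M + 1))
          fun k hk => (Finset.mem_filter.1 hk).2).trans_eq ?_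
        simp
      refine mul_le_mul_of_nonneg_right ?_ hc₂0
      have h2 := Nat.floor_le hM0
      have h3 : (((Finset.Icc 1 ⌊T⌋₊).filter (· ∈ Finset.Icc 1 (M + 1))).card : ℝ) ≤ M + 1 := by
        exact_mod_cast this
      linarith
    · rw [Finset.sum_const, nsmul_eq_mul]
      refine mul_le_mul_of_nonneg_right ?_ hc₃0
      simpa using Nat.floor_le hT0
  have hTc : T * c₃ ≤ Real.exp (3 * β) * (p⁻¹ * Real.exp (-(ε / 2) * p⁻¹)) := by
    have e1 : T * c₃ = p⁻¹ * Real.exp ((b - ε) / p - (1 - p) ^ 3 * β / p) := by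
      rw [hT, hc₃, Real.exp_sub, Real.exp_neg]; ring
    have e2 : Real.exp (3 * β) * (p⁻¹ * Real.exp (-(ε / 2) * p⁻¹)) =
        p⁻¹ * Real.exp (3 * β + -(ε / 2) * p⁻¹) := by
      rw [Real.exp_add]; ring
    rw [e1, e2]
    refine mul_le_mul_of_nonneg_left (Real.exp_le_exp.2 ?_) (inv_nonneg.2 hp0.le)
    have h3 : 1 - 3 * p ≤ (1 - p) ^ 3 := by nlinarith
    have h4 : b - ε - (1 - p) ^ 3 * β ≤ 3 * β * p - ε / 2 := by nlinarith
    have h5 : (b - ε) / p - (1 - p) ^ 3 * β / p = (b - ε - (1 - p) ^ 3 * β) * p⁻¹ := by ring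
    have h6 : 3 * β + -(ε / 2) * p⁻¹ = (3 * β * p - ε / 2) * p⁻¹ := by field_simp; ring
    rw [h5, h6]
    exact mul_le_mul_of_nonneg_right h4 (inv_nonneg.2 hp0.le)
  calc (iidLaw ν).real {x | ∃ k : ℕ, 1 ≤ k ∧ (k : ℝ) ≤ T ∧ Fills ∅ k x}
      ≤ (iidLaw ν).real (⋃ k ∈ Finset.Icc 1 ⌊T⌋₊, {x | Fills ∅ k x}) :=
        measureReal_mono hsub (measure_ne_top _ _)
    _ ≤ ∑ k ∈ Finset.Icc 1 ⌊T⌋₊, fillProb ν k := measureReal_biUnion_finset_le _ _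
    _ ≤ c₁ + (2 * A / p + 1) * c₂ + T * c₃ := hsum
    _ ≤ earlyBound A β ε p := by
        have e : (2 * A / p + 1) * c₂ = (2 * A + p) * (16 * p) / (1 - p) ^ 3 := by
          rw [hc₂]; field_simp
        rw [earlyBound, e]
        linarith

/-- The constants needed in `prob_early_le` exist because the integral in `b` converges. -/
lemma exists_cutoff {ε : ℝ} (hε : 0 < ε) : ∃ A β : ℝ, 0 ≤ A ∧ 0 ≤ β ∧
    β ≤ Real.log 2 + ∫ y in (0 : ℝ)..A, rate y ∧ β ≤ A * Real.log 2 ∧ b - ε / 2 ≤ β := by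
  have h1 : Tendsto (fun A : ℝ => Real.log 2 + ∫ y in (0 : ℝ)..A, rate y) atTop (𝓝 b) := by
    rw [b_eq]
    exact (intervalIntegral_tendsto_integral_Ioi 0 integrableOn_rate tendsto_id).const_add _
  set β := max 0 (b - ε / 2) with hβ
  have h2 : Tendsto (fun A : ℝ => A * Real.log 2) atTop atTop :=
    tendsto_id.atTop_mul_const log_two_pos
  obtain ⟨A, hA0, hA1, hA2⟩ := ((eventually_ge_atTop (0 : ℝ)).and
    ((h1.eventually_const_le (show b - ε / 2 < b by linarith)).and
      (h2.eventually_ge_atTop β))).exists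
  refine ⟨A, β, hA0, le_max_left _ _, max_le ?_ hA1, hA2, le_max_right _ _⟩
  have := intervalIntegral.integral_nonneg (μ := volume) hA0 fun y _ => rate_nonneg y
  linarith [log_two_pos]

lemma prob_late_le {p : ℝ} (hp : p ∈ Set.Ioo (0 : ℝ) 1) {ν : Measure ℕ}
    [IsProbabilityMeasure ν] (hν : ∀ j, ν.real {j} = geo p j) (δ : ℝ) :
    (iidLaw ν).real {x | ∀ k : ℕ, 1 ≤ k → (k : ℝ) ≤ Real.exp ((b + δ) / p) → ¬ Fills ∅ k x} ≤
      Real.exp (1 - δ * p⁻¹) := by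
  set T := Real.exp ((b + δ) / p) with hT
  set c := Real.exp (-(b / p) - 1) with hc
  have hsub : {x | ∀ k : ℕ, 1 ≤ k → (k : ℝ) ≤ T → ¬ Fills ∅ k x} ⊆ {x | Avoids ∅ 0 ⌊T⌋₊ x} := by
    intro x hx m hm
    rw [Finset.mem_Ioc] at hm
    exact hx m hm.1 ((Nat.le_floor_iff (Real.exp_pos _).le).1 hm.2)
  refine (measureReal_mono hsub).trans ?_
  have h := renewal_bound hp hν (le_fillProb hp hν) ⌊T⌋₊
  set B := (iidLaw ν).real {x | Avoids ∅ 0 ⌊T⌋₊ x}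
  have hB : 0 ≤ B := measureReal_nonneg
  have hTc : T * c * Real.exp (1 - δ * p⁻¹) = 1 := by
    rw [hT, hc, ← Real.exp_add, ← Real.exp_add, Real.exp_eq_one_iff]
    ring
  have hTc0 : 0 < T * c := mul_pos (Real.exp_pos _) (Real.exp_pos _)
  have h2 : T * c * B ≤ T * c * Real.exp (1 - δ * p⁻¹) := by
    rw [hTc]
    refine le_trans ?_ h
    rw [mul_assoc]
    exact mul_le_mul_of_nonneg_right (Nat.lt_floor_add_one T).le
      (mul_nonneg (Real.exp_pos _).le hB)
  exact le_of_mul_le_mul_left h2 hTc0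

lemma measurable_seq {Ω : Type*} [MeasurableSpace Ω] {X : ℕ → Ω → ℕ}
    (hmeas : ∀ n, Measurable (X n)) : Measurable fun ω n => X n ω :=
  measurable_pi_iff.2 hmeas

/-- Transfer of a bound for an i.i.d. sequence to the probability space of `X`. -/
lemma prob_le_of_law {Ω : Type*} [MeasurableSpace Ω] {P : Measure Ω} {X : ℕ → Ω → ℕ}
    (hmeas : ∀ n, Measurable (X n)) {ν : Measure ℕ} [IsProbabilityMeasure ν]
    (hlaw : P.map (fun ω n => X n ω) = iidLaw ν) {E : Set (ℕ → ℕ)} {r : ℝ}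
    (h : (iidLaw ν).real E ≤ r) : P {ω | (fun n => X n ω) ∈ E} ≤ ENNReal.ofReal r := by
  calc P {ω | (fun n => X n ω) ∈ E} ≤ P.map (fun ω n => X n ω) E :=
        Measure.le_map_apply (measurable_seq hmeas).aemeasurable E
    _ = ENNReal.ofReal ((iidLaw ν).real E) := by rw [hlaw, ofReal_measureReal]
    _ ≤ ENNReal.ofReal r := ENNReal.ofReal_le_ofReal h

end BiasedPermutation

theorem theorem2
    {Ω : ℝ → Type*} [∀ p, MeasurableSpace (Ω p)]
    (P : ∀ p, Measure (Ω p)) (X : ∀ p, ℕ → Ω p → ℕ)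
    (hP : ∀ p ∈ Set.Ioo (0 : ℝ) 1, IsProbabilityMeasure (P p))
    (hmeas : ∀ p ∈ Set.Ioo (0 : ℝ) 1, ∀ n, Measurable (X p n))
    (hindep : ∀ p ∈ Set.Ioo (0 : ℝ) 1, iIndepFun (X p) (P p))
    (hgeo : ∀ p ∈ Set.Ioo (0 : ℝ) 1, ∀ n j : ℕ, 1 ≤ j →
      P p {ω | X p n ω = j} = ENNReal.ofReal (p * (1 - p) ^ (j - 1))) :
    (∀ ε : ℝ, 0 < ε →
      Tendsto
        (fun p : ℝ => P p {ω | ENNReal.ofReal (Real.exp ((BiasedPermutation.b - ε) / p)) <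
          (BiasedPermutation.blockSize (fun n => X p n ω) : ENNReal)})
        (𝓝[>] 0) (𝓝 1)) ∧
    (∀ δ : ℝ, 0 < δ →
      Tendsto
        (fun p : ℝ => P p {ω | ¬ ∃ k : ℕ, BiasedPermutation.blockSize (fun n => X p n ω) = k ∧
          |p * Real.log k - BiasedPermutation.b| < δ})
        (𝓝[>] 0) (𝓝 0)) := by
  open BiasedPermutation in
  have hlaw : ∀ p ∈ Set.Ioo (0 : ℝ) 1, ∃ (ν : Measure ℕ) (_ : IsProbabilityMeasure ν),
      (∀ j, ν.real {j} = geo p j) ∧ (P p).map (fun ω n => X p n ω) = iidLaw ν := fun p hp =>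
    have := hP p hp
    exists_law hp (hmeas p hp) (hindep p hp) (hgeo p hp)
  have hIoo : ∀ᶠ p : ℝ in 𝓝[>] 0, p ∈ Set.Ioo (0 : ℝ) 1 := Ioo_mem_nhdsGT one_pos
  have hearly : ∀ ε : ℝ, 0 < ε → Tendsto (fun p : ℝ => P p {ω | ∃ k : ℕ, 1 ≤ k ∧
      (k : ℝ) ≤ Real.exp ((b - ε) / p) ∧ Fills ∅ k (fun n => X p n ω)}) (𝓝[>] 0) (𝓝 0) := by
    intro ε hε
    obtain ⟨A, β, hA, hβ0, hβ, hβA, hβε⟩ := exists_cutoff hε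
    have hlim := ENNReal.tendsto_ofReal (tendsto_earlyBound A β hε)
    rw [ENNReal.ofReal_zero] at hlim
    refine tendsto_of_tendsto_of_tendsto_of_le_of_le' tendsto_const_nhds hlim
      (Eventually.of_forall fun _ => zero_le) ?_
    filter_upwards [hIoo] with p hp
    obtain ⟨ν, hνp, hν, hmap⟩ := hlaw p hp
    exact prob_le_of_law (hmeas p hp) hmap (prob_early_le hp hν hA hβ0 hβ hβA hβε)
  have hlate : ∀ δ : ℝ, 0 < δ → Tendsto (fun p : ℝ => P p {ω | ∀ k : ℕ, 1 ≤ k →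
      (k : ℝ) ≤ Real.exp ((b + δ) / p) → ¬ Fills ∅ k (fun n => X p n ω)}) (𝓝[>] 0) (𝓝 0) := by
    intro δ hδ
    have h1 : Tendsto (fun p : ℝ => Real.exp (1 - δ * p⁻¹)) (𝓝[>] 0) (𝓝 0) := by
      refine Real.tendsto_exp_atBot.comp (tendsto_atBot_add_const_left _ 1 ?_)
      exact tendsto_neg_atTop_atBot.comp (tendsto_inv_nhdsGT_zero.const_mul_atTop hδ)
    have hlim := ENNReal.tendsto_ofReal h1
    rw [ENNReal.ofReal_zero] at hlim
    refine tendsto_of_tendsto_of_tendsto_of_le_of_le' tendsto_const_nhds hlim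
      (Eventually.of_forall fun _ => zero_le) ?_
    filter_upwards [hIoo] with p hp
    obtain ⟨ν, hνp, hν, hmap⟩ := hlaw p hp
    exact prob_le_of_law (hmeas p hp) hmap (prob_late_le hp hν δ)
  constructor
  · intro ε hε
    have hlim := ENNReal.Tendsto.sub (tendsto_const_nhds (x := (1 : ENNReal))) (hearly ε hε)
      (Or.inl ENNReal.one_ne_top)
    rw [tsub_zero] at hlim
    refine tendsto_of_tendsto_of_tendsto_of_le_of_le' hlim tendsto_const_nhds ?_ ?_
    · filter_upwards [hIoo] with p hp
      have := hP p hp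
      rw [tsub_le_iff_right, ← measure_univ (μ := P p)]
      refine (measure_mono fun ω _ => ?_).trans (measure_union_le _ _)
      rw [Set.mem_union]
      by_contra! hω
      simp only [Set.mem_ofPred_eq, not_lt, not_exists, not_and] at hω
      rcases blockSize_cases (fun n => X p n ω) with ⟨h, -⟩ | ⟨k, h, hk1, hk2, -⟩
      · rw [h] at hω
        simp at hω
      · refine hω.2 k hk1 ?_ hk2
        have := hω.1
        rw [h, ENat.toENNReal_coe, ← ENNReal.ofReal_natCast,
          ENNReal.ofReal_le_ofReal_iff (Real.exp_pos _).le] at this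
        exact this
    · filter_upwards [hIoo] with p hp
      have := hP p hp
      exact prob_le_one
  · intro δ hδ
    have hlim := (hearly δ hδ).add (hlate (δ / 2) (half_pos hδ))
    rw [add_zero] at hlim
    refine tendsto_of_tendsto_of_tendsto_of_le_of_le' tendsto_const_nhds hlim
      (Eventually.of_forall fun _ => zero_le) ?_
    filter_upwards [hIoo] with p hp
    have hp0 := hp.1
    refine (measure_mono fun ω hω => ?_).trans (measure_union_le _ _)
    rcases blockSize_cases (fun n => X p n ω) with ⟨-, h⟩ | ⟨k, h, hk1, hk2, hk3⟩
    · exact Or.inr fun k hk _ => h k hk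
    · have hkpos : (0 : ℝ) < k := by exact_mod_cast hk1
      by_cases hsmall : (k : ℝ) ≤ Real.exp ((b - δ) / p)
      · exact Or.inl ⟨k, hk1, hsmall, hk2⟩
      · refine Or.inr fun j hj hjT => hk3 j hj ?_
        by_contra! hkj
        have h1 : (k : ℝ) ≤ Real.exp ((b + δ / 2) / p) :=
          le_trans (by exact_mod_cast hkj) hjT
        refine hω ⟨k, h, abs_lt.2 ⟨?_, ?_⟩⟩
        · have h2 := (Real.lt_log_iff_exp_lt hkpos).2 (not_le.1 hsmall)
          rw [div_lt_iff₀ hp0] at h2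
          linarith
        · have h2 := (Real.log_le_iff_le_exp hkpos).2 h1
          rw [le_div_iff₀ hp0] at h2
          linarith
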